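/- **Theorem (Recovery after the occurrence of transient faults).** *Setting.* There are $N\ge 2$ nodes $p_1,\dots,p_N$; each hosts a server and at most one client at a time. Let $f,e\ge 0$, $k\ge 1$ with $k+2(f+e)\le N$; a quorum is a set of at least $\lceil (N+k+2e)/2\rceil$ servers. Tags are pairs $(z,j)$ (a number and a node identifier), ordered lexicographically, with least element $t_0$. Nodes exchange messages over reliable FIFO channels, one for each ordered pair of distinct nodes. *The algorithm.* A server stores a finite set $S$ of records (tag, word or $\bot$, phase), with phases `pre', `fin', `FIN'. A call of $\mathrm{qrmAccess}(m)$ sends the request $m$ to the servers (possibly repeatedly) until acknowledgments of $m$ from a quorum have been received, and then returns them. A writer at $p_i$ queries a quorum for the maximal stored tag $(z,j)$, and then makes three more calls with the tag $(z+1,i)$: pre-write (which also carries to each server its share of the encoded secret), finalize (`fin') and FINALIZE (`FIN'). A reader queries a quorum for the maximal tag $t$ of phase `fin' or `FIN', then calls finalize with $t$, and decodes the shares that it receives. A server answers queries by its maximal tag ($t_0$ if it has none), and on each other request it inserts or updates the record with the tag of the request; at most $e$ servers may corrupt the shares that they send to readers. Servers keep gossiping their triples of maximal tags over all phases, over $\{$`fin',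 `FIN'$\}$, and over $\{$`FIN'$\}$; when gossip arrives, a server inserts or updates the records of the maximal tags of each phase that are known to it from its storage and from the last gossip of every server (a tag that a quorum reports as its maximal finalized tag counts as FINALIZED), and renews its own gossip message. *Executions.* An execution is an infinite sequence $R=c_0,a_0,c_1,a_1,\dots$ of system states and atomic steps; $c_0$ is arbitrary. $R$ is *fair* if every step, other than the invocation of an operation, that is applicable infinitely often is taken infinitely often. $R$ is *legal with respect to the gossip and quorum services* if (a) for all distinct servers $p_j,p_l$, every gossip message from $p_j$ that is delivered at $p_l$ was sent by $p_j$ earlier in $R$, and such deliveries occur infinitely often; and (b) every call of $\mathrm{qrmAccess}$ in $R$ returns, and it returns only after a quorum of servers has received, delivered and acknowledged the request of that call and the client has received these acknowledgments. *Cycles.* The first asynchronous cycle of an execution is its shortest prefix in which (i) for every server $p_i$, first a gossip message from another server arrives at $p_i$, and then, for every other $p_j$, a gossip message sent thereafter by $p_i$ arrives at $p_j$ and a gossip message sent thereafter by $p_j$ arrives at $p_i$; and (ii) every node that runs a client in the prefix completes in it at least one client round (one return of $\mathrm{qrmAccess}$). Further cycles are defined by iterating this on the remaining suffix. *Operations.*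 An operation consists of the steps of one run of a client procedure, including the receptions of its requests by servers and of the replies by the client. It is *incomplete* if its first step in $R$ is not the first line of its procedure, i.e., it stems from the starting state (the client is running, or its requests or replies to it are in transit, in $c_0$); it is *complete* if its run starts with the first line and ends with the last line of the procedure. Let $T(c)$ be the set of tags that appear in state $c$, in the nodes or in transit. A write operation $\pi$ with tag $T(\pi)$ (the tag of its pre-write) is *valid* if it is complete and there is a state $c$ in $R$ before the starting state of $\pi$ such that $T(\pi)>t$ for every $t\in T(c_0)\cap T(c)$. *Claim.* There are absolute constants $C_1,C_2$ such that for all $N,k,e,f$ as above, every coding scheme, and every fair execution $R$ of the algorithm that is legal with respect to the gossip and quorum services and has an arbitrary starting state, the following holds. Within $C_1$ asynchronous cycles, $R$ reaches a suffix $R'$ that includes no (part of an) incomplete operation. Within $C_2$ further asynchronous cycles, counted from the start of $R'$, $R'$ reaches a suffix $R''$ such that every write operation of which $R''$ includes a part is valid. -/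

import Mathlib

universe u v

namespace CAS

noncomputable section

open scoped Classical

/-! ### Tags, records, messages -/

/-- Tags `(z, j)`: a sequence number and a node identifier, ordered lexicographically.
The default tag `t₀` is the least tag `⊥ = (0, 0)`. -/
abbrev Tag (N : ℕ) : Type := ℕ ×ₗ Fin N

/-- A quorum is a set of at least `⌈(N + k + 2e) / 2⌉` servers. -/
def IsQuorum {N : ℕ} (k e : ℕ) (A : Finset (Fin N)) : Prop :=
  N + k + 2 * e ≤ 2 * A.card

/-- The coding scheme `Φ` (every `k + 2e` shares, at most `e` of them corrupted, determine the
secret) together with the set of servers that may corrupt the shares they send to readers. -/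
structure Setup (N k e : ℕ) (Sec : Type u) (Word : Type v) where
  encode : Sec → Fin N → Word
  decode : (Fin N → Option Word) → Sec
  decode_encode : ∀ (s : Sec) (sh : Fin N → Option Word),
    k + 2 * e ≤ (Finset.univ.filter fun j => sh j ≠ none).card →
    (Finset.univ.filter fun j => ∃ w, sh j = some w ∧ w ≠ encode s j).card ≤ e →
    decode sh = s
  corrupt : Finset (Fin N)
  corrupt_card : corrupt.card ≤ e

inductive Phase : Type
  | pre
  | fin
  | FIN

inductive Role : Type
  | writer
  | reader

/-- A storage record `(t, w, d)`; the word `none` is `⊥`. -/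
structure Record (N : ℕ) (Word : Type v) where
  tag : Tag N
  word : Option Word
  phase : Phase

/-- A gossip message (write tag, read tag, anchor tag). -/
structure Triple (N : ℕ) where
  pre : Tag N
  fin : Tag N
  FIN : Tag N

def Triple.tags {N : ℕ} (g : Triple N) : Set (Tag N) := {g.pre, g.fin, g.FIN}

/-- A client request to a server: query, pre-write `(t, w, 'pre')`, finalize `(t, ⊥, 'fin')`,
FINALIZE `(t, ⊥, 'FIN')`. -/
inductive Request (N : ℕ) (Word : Type v) : Type v
  | qry (r : Role)
  | pre (t : Tag N) (w : Option Word)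
  | fin (r : Role) (t : Tag N)
  | FIN (r : Role) (t : Tag N)

def Request.tags {N : ℕ} {Word : Type v} : Request N Word → Set (Tag N)
  | .qry _ => ∅
  | .pre t _ => {t}
  | .fin _ t => {t}
  | .FIN _ t => {t}

structure Reply (N : ℕ) (Word : Type v) where
  tag : Tag N
  word : Option Word

/-- Messages in transit. An acknowledgment carries the request that it answers. -/
inductive Msg (N : ℕ) (Word : Type v) : Type v
  | gossip (g : Triple N)
  | request (q : Request N Word)
  | ack (q : Request N Word) (a : Reply N Word)

def Msg.tags {N : ℕ} {Word : Type v} : Msg N Word → Set (Tag N)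
  | .gossip g => g.tags
  | .request q => q.tags
  | .ack q a => insert a.tag q.tags

/-! ### The server -/

section Server

variable {N : ℕ} {Word : Type v}

def upgradePhase : Phase → Phase → Phase
  | .pre, .fin => .fin
  | .fin, .FIN => .FIN
  | old, _ => old

/-- `updatePhase(t, w, u)` turns the storage `S` into `S'`. It is a relation, since an arbitrary
storage may hold several records with the tag `t`. -/
def UpdatePhase (S : Finset (Record N Word)) (t : Tag N) (w : Option Word) (d : Phase)
    (S' : Finset (Record N Word)) : Prop :=
  (∃ s ∈ S, s.tag = t ∧ s.word ≠ none ∧ w = none ∧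
      S' = insert ⟨t, s.word, upgradePhase s.phase d⟩ (S.erase s)) ∨
  ((¬ ∃ s ∈ S, s.tag = t ∧ s.word ≠ none ∧ w = none) ∧
      S' = insert ⟨t, w, d⟩ (S.filter fun s => s.tag ≠ t))

variable [NeZero N]

/-- `maxPhase(D)`: the maximal stored tag with a phase in `D`, and `t₀ = ⊥` if there is none. -/
def maxPhase (S : Finset (Record N Word)) (D : Set Phase) : Tag N :=
  (S.filter fun s => s.phase ∈ D).sup Record.tag

def tagTuple (S : Finset (Record N Word)) : Triple N :=
  ⟨maxPhase S Set.univ, maxPhase S {Phase.fin, Phase.FIN}, maxPhase S {Phase.FIN}⟩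

/-- The reply to a finalize or FINALIZE request with the tag `t` and the phase `d`. A corrupting
server may send any word to a reader. -/
def FinReply (corrupt : Prop) (S : Finset (Record N Word)) (r : Role) (t : Tag N) (d : Phase)
    (a : Reply N Word) : Prop :=
  a.tag = t ∧
  match r with
  | .writer => a.word = none
  | .reader => corrupt ∨ (∃ s ∈ S, s.tag = t ∧ s.phase = d ∧ a.word = s.word) ∨
      ((¬ ∃ s ∈ S, s.tag = t ∧ s.phase = d) ∧ a.word = none)

/-- The server handles a client request: storage `S` becomes `S'` and the reply is `a`. -/
def Serve (corrupt : Prop) (S : Finset (Record N Word)) (q : Request N Word)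
    (S' : Finset (Record N Word)) (a : Reply N Word) : Prop :=
  match q with
  | .qry .reader => S' = S ∧ a = ⟨maxPhase S {Phase.fin, Phase.FIN}, none⟩
  | .qry .writer => S' = S ∧ a = ⟨maxPhase S Set.univ, none⟩
  | .pre t w => UpdatePhase S t w .pre S' ∧ a = ⟨t, none⟩
  | .fin r t => UpdatePhase S t none .fin S' ∧ FinReply corrupt S' r t .fin a
  | .FIN r t => UpdatePhase S t none .FIN S' ∧ FinReply corrupt S' r t .FIN a

/-- The gossip handler of the server at `i`, where `g` holds the most recently received gossip
message of every server (and the values that `i` itself aggregated, as `g i`): the storage `S`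
becomes `S'` and the new value of `g i` is `m`. -/
def GossipUpdate (k e : ℕ) (i : Fin N) (g : Fin N → Triple N)
    (S S' : Finset (Record N Word)) (m : Triple N) : Prop :=
  ∃ S₁ S₂ : Finset (Record N Word),
    m.pre = (Finset.univ.sup fun l => (g l).pre ⊔ (g l).fin ⊔ (g l).FIN) ⊔
      maxPhase S Set.univ ∧
    UpdatePhase S m.pre none .pre S₁ ∧
    m.fin = (Finset.univ.sup fun l => (g l).fin ⊔ (g l).FIN) ⊔
      maxPhase S₁ {Phase.fin, Phase.FIN} ∧
    UpdatePhase S₁ m.fin none .fin S₂ ∧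
    m.FIN = (Finset.univ.sup fun l => (g l).FIN) ⊔ maxPhase S₂ {Phase.FIN} ⊔
      (Finset.univ.filter fun l => IsQuorum k e (Finset.univ.filter fun l' =>
          (Function.update g i ⟨m.pre, m.fin, (g i).FIN⟩ l').fin =
            (Function.update g i ⟨m.pre, m.fin, (g i).FIN⟩ l).fin)).sup
        (fun l => (Function.update g i ⟨m.pre, m.fin, (g i).FIN⟩ l).fin) ∧
    UpdatePhase S₂ m.FIN none .FIN S'

end Server

/-! ### The client -/

/-- The round (call of `qrmAccess`) in which a running client is: the query, pre-write, finalize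
and FINALIZE rounds of a writer, the query and finalize rounds of a reader. -/
inductive Round (N : ℕ) (Sec : Type u) : Type u
  | wQry (s : Sec)
  | wPre (s : Sec) (t : Tag N)
  | wFin (t : Tag N)
  | wFIN (t : Tag N)
  | rQry
  | rFin (t : Tag N)

def Round.IsWrite {N : ℕ} {Sec : Type u} : Round N Sec → Prop
  | .wQry _ => True
  | .wPre _ _ => True
  | .wFin _ => True
  | .wFIN _ => True
  | .rQry => False
  | .rFin _ => False

def Round.tags {N : ℕ} {Sec : Type u} : Round N Sec → Set (Tag N)
  | .wQry _ => ∅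
  | .wPre _ t => {t}
  | .wFin t => {t}
  | .wFIN t => {t}
  | .rQry => ∅
  | .rFin t => {t}

/-- The request that a client sends to the server at `j` in a round. -/
def Round.request {N k e : ℕ} {Sec : Type u} {Word : Type v} (P : Setup N k e Sec Word)
    (j : Fin N) : Round N Sec → Request N Word
  | .wQry _ => .qry .writer
  | .wPre s t => .pre t (some (P.encode s j))
  | .wFin t => .fin .writer t
  | .wFIN t => .FIN .writer t
  | .rQry => .qry .reader
  | .rFin t => .fin .reader t

/-- A node runs no client, or one client that waits in a round for the acknowledgments of a quorum
and has collected `acks` so far. -/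
inductive Client (N : ℕ) (Sec : Type u) (Word : Type v) : Type (max u v)
  | idle
  | busy (r : Round N Sec) (acks : Fin N → Option (Reply N Word))

def Client.tags {N : ℕ} {Sec : Type u} {Word : Type v} : Client N Sec Word → Set (Tag N)
  | .idle => ∅
  | .busy r acks => r.tags ∪ {t | ∃ j a, acks j = some a ∧ a.tag = t}

/-- The maximal tag in the collected acknowledgments. -/
def maxAck {N : ℕ} [NeZero N] {Word : Type v} (acks : Fin N → Option (Reply N Word)) : Tag N :=
  Finset.univ.sup fun j => ((acks j).map Reply.tag).getD ⊥

/-- What the client at `i` does when `qrmAccess` returns: it calls `qrmAccess` for its next round,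
or its procedure ends. -/
def nextClient {N : ℕ} [NeZero N] {Sec : Type u} {Word : Type v} (i : Fin N) (r : Round N Sec)
    (acks : Fin N → Option (Reply N Word)) : Client N Sec Word :=
  match r with
  | .wQry s => .busy (.wPre s (toLex ((ofLex (maxAck acks)).1 + 1, i))) fun _ => none
  | .wPre _ t => .busy (.wFin t) fun _ => none
  | .wFin t => .busy (.wFIN t) fun _ => none
  | .wFIN _ => .idle
  | .rQry => .busy (.rFin (maxAck acks)) fun _ => none
  | .rFin _ => .idle

/-- The value that a reader returns: the decoded secret, or `none` (`⊥`) if there are too few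
shares. -/
def readResult {N k e : ℕ} {Sec : Type u} {Word : Type v} (P : Setup N k e Sec Word)
    (acks : Fin N → Option (Reply N Word)) : Option Sec :=
  if k + 2 * e ≤ (Finset.univ.filter fun j => (acks j).bind Reply.word ≠ none).card then
    some (P.decode fun j => (acks j).bind Reply.word)
  else none

/-! ### System states and steps -/

/-- A system state. `gossip i l` is the gossip message that the server at `i` received last from the
server at `l ≠ i`, and `gossip i i` holds its own aggregated values `(pre[i], fin[i], FIN[i])`;
`gossipTx i` is the argument of its last call of `gossip()`; `output i` is the last value that a
reader at `i` returned; for `i ≠ j`, `chan i j` is the (reliable, FIFO) channel from `i` to `j`,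
oldest message first. -/
structure State (N : ℕ) (Sec : Type u) (Word : Type v) where
  store : Fin N → Finset (Record N Word)
  gossip : Fin N → Fin N → Triple N
  gossipTx : Fin N → Triple N
  client : Fin N → Client N Sec Word
  output : Fin N → Option Sec
  chan : Fin N → Fin N → List (Msg N Word)

/-- All tags that appear in a system state: in the storages, in the other server variables, in the
clients, and in the messages in transit. -/
def State.tags {N : ℕ} {Sec : Type u} {Word : Type v} (c : State N Sec Word) : Set (Tag N) :=
  {t | (∃ i, ∃ s ∈ c.store i, s.tag = t) ∨ (∃ i l, t ∈ (c.gossip i l).tags) ∨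
    (∃ i, t ∈ (c.gossipTx i).tags) ∨ (∃ i, t ∈ (c.client i).tags) ∨
    ∃ i j, i ≠ j ∧ ∃ m ∈ c.chan i j, t ∈ m.tags}

/-- The kinds of steps. `requestSend i j`: the quorum service at `i` transmits the current request
of `i`'s client to the server at `j ≠ i`; `localAccess i`: it passes that request to the server at
`i` itself; `ret i`: `qrmAccess` returns at `i`; `gossipSend i j`: the gossip service at `i`
transmits to `j`; `recv i j`: node `j` receives the oldest message of the channel from `i`. -/
inductive Action (N : ℕ) (Sec : Type u) : Type u
  | invokeWrite (i : Fin N) (s : Sec)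
  | invokeRead (i : Fin N)
  | requestSend (i j : Fin N)
  | localAccess (i : Fin N)
  | ret (i : Fin N)
  | gossipSend (i j : Fin N)
  | recv (i j : Fin N)

def Action.IsInvocation {N : ℕ} {Sec : Type u} : Action N Sec → Prop
  | .invokeWrite _ _ => True
  | .invokeRead _ => True
  | _ => False

/-- Replace the content of the channel from `i` to `j` by `l`. -/
def setChan {N : ℕ} {α : Type v} (ch : Fin N → Fin N → α) (i j : Fin N) (l : α) :
    Fin N → Fin N → α :=
  Function.update ch i (Function.update (ch i) j l)

section Steps

variable {N k e : ℕ} [NeZero N] {Sec : Type u} {Word : Type v}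

/-- The client collects an acknowledgment of its current request and ignores any other. -/
def collect (P : Setup N k e Sec Word) (i : Fin N) (q : Request N Word) (a : Reply N Word) :
    Client N Sec Word → Client N Sec Word
  | .idle => .idle
  | .busy r acks =>
    if r.request P i = q then .busy r (Function.update acks i (some a)) else .busy r acks

/-- Node `j` receives the message `m`, the head of the channel from `i`, whose remainder is `l`. -/
def Receive (P : Setup N k e Sec Word) (c : State N Sec Word) (i j : Fin N) (m : Msg N Word)
    (l : List (Msg N Word)) (c' : State N Sec Word) : Prop :=
  match m with
  | .gossip g => ∃ (S' : Finset (Record N Word)) (m' : Triple N),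
      GossipUpdate k e j (Function.update (c.gossip j) i g) (c.store j) S' m' ∧
      c' = { c with
        store := Function.update c.store j S'
        gossip := Function.update c.gossip j
          (Function.update (Function.update (c.gossip j) i g) j m')
        gossipTx := Function.update c.gossipTx j (tagTuple S')
        chan := setChan c.chan i j l }
  | .request q => ∃ (S' : Finset (Record N Word)) (a : Reply N Word),
      Serve (j ∈ P.corrupt) (c.store j) q S' a ∧
      c' = { c with
        store := Function.update c.store j S'
        chan := setChan (setChan c.chan i j l) j i (c.chan j i ++ [.ack q a]) }
  | .ack q a =>
      c' = { c with
        client := Function.update c.client j (collect P i q a (c.client j))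
        chan := setChan c.chan i j l }

/-- The step relation of the algorithm over the gossip and quorum services. -/
def Step (P : Setup N k e Sec Word) (c : State N Sec Word) (x : Action N Sec)
    (c' : State N Sec Word) : Prop :=
  match x with
  | .invokeWrite i s => c.client i = .idle ∧
      c' = { c with client := Function.update c.client i (.busy (.wQry s) fun _ => none) }
  | .invokeRead i => c.client i = .idle ∧
      c' = { c with client := Function.update c.client i (.busy .rQry fun _ => none) }
  | .requestSend i j => i ≠ j ∧ ∃ r acks, c.client i = .busy r acks ∧
      c' = { c with chan := setChan c.chan i j (c.chan i j ++ [.request (r.request P j)]) }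
  | .localAccess i => ∃ r acks, c.client i = .busy r acks ∧
      ∃ (S' : Finset (Record N Word)) (a : Reply N Word),
        Serve (i ∈ P.corrupt) (c.store i) (r.request P i) S' a ∧
        c' = { c with
          store := Function.update c.store i S'
          client := Function.update c.client i
            (.busy r (Function.update acks i (some a))) }
  | .ret i => ∃ r acks, c.client i = .busy r acks ∧
      IsQuorum k e (Finset.univ.filter fun j => acks j ≠ none) ∧
      c' = { c with
        client := Function.update c.client i (nextClient i r acks)
        output := match r with
          | .rFin _ => Function.update c.output i (readResult P acks)
          | _ => c.output }
  | .gossipSend i j => i ≠ j ∧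
      c' = { c with chan := setChan c.chan i j (c.chan i j ++ [.gossip (c.gossipTx i)]) }
  | .recv i j => i ≠ j ∧ ∃ m l, c.chan i j = m :: l ∧ Receive P c i j m l c'

/-! ### Executions, fairness -/

/-- An (unbounded) execution `c₀, a₀, c₁, a₁, …`, with an arbitrary starting system state. -/
structure Execution (P : Setup N k e Sec Word) where
  st : ℕ → State N Sec Word
  act : ℕ → Action N Sec
  step : ∀ n, Step P (st n) (act n) (st (n + 1))

namespace Execution

variable {P : Setup N k e Sec Word} (R : Execution P)

/-- Every step that is applicable infinitely often is taken infinitely often. The invocation of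
operations is up to the environment. -/
def Fair : Prop :=
  ∀ x : Action N Sec, ¬ x.IsInvocation →
    (∀ m, ∃ n, m ≤ n ∧ ∃ c', Step P (R.st n) x c') → ∀ m, ∃ n, m ≤ n ∧ R.act n = x

/-- The message that step `s` puts into the channel from `i` to `j` is the one that is received in
step `d`: the channel being FIFO, as many messages are received from step `s + 1` to step `d` as
the channel holds right after step `s`. -/
def ReceivedAt (i j : Fin N) (s d : ℕ) : Prop :=
  s < d ∧ R.act d = .recv i j ∧
    ((Finset.Ioo s d).filter fun p => R.act p = .recv i j).card + 1 =
      ((R.st (s + 1)).chan i j).length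

/-- Step `d` receives a message that the channel from `i` to `j` holds in the starting state. -/
def ReceivesInitial (i j : Fin N) (d : ℕ) : Prop :=
  R.act d = .recv i j ∧
    ((Finset.range d).filter fun p => R.act p = .recv i j).card < ((R.st 0).chan i j).length

/-- In step `n`, node `j` receives the gossip message `g` from `i`. -/
def DeliversGossip (i j : Fin N) (g : Triple N) (n : ℕ) : Prop :=
  R.act n = .recv i j ∧ ((R.st n).chan i j).head? = some (.gossip g)

/-! ### Legal executions of the gossip and quorum services -/

/-- Correct gossip from `i` to `j`: every delivered message was sent by `i` earlier, and deliveries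
occur infinitely often. -/
def GossipCorrect (i j : Fin N) : Prop :=
  (∀ n g, R.DeliversGossip i j g n →
    ∃ s < n, R.act s = .gossipSend i j ∧ (R.st s).gossipTx i = g) ∧
  ∀ m, ∃ n g, m ≤ n ∧ R.DeliversGossip i j g n

/-- In step `a` the client at `i` calls `qrmAccess`. -/
def CallsQrm (i : Fin N) (a : ℕ) : Prop :=
  ((∃ s, R.act a = .invokeWrite i s) ∨ R.act a = .invokeRead i ∨ R.act a = .ret i) ∧
    (R.st (a + 1)).client i ≠ .idle

/-- Between the steps `a` and `b`, the server at `j` receives, delivers and acknowledges a request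
that the client at `i` sends after `a`, and the client receives that acknowledgment. -/
def Served (i j : Fin N) (a b : ℕ) : Prop :=
  (i = j ∧ ∃ d, a < d ∧ d < b ∧ R.act d = .localAccess i) ∨
  (i ≠ j ∧ ∃ s d x, a < s ∧ R.act s = .requestSend i j ∧ R.ReceivedAt i j s d ∧
    R.ReceivedAt j i d x ∧ x < b)

/-- Correct quorum-based communication of the client at `i`: every call of `qrmAccess` returns, and
it returns only after a quorum of servers has received, delivered and acknowledged the request of
that call and the client has received these acknowledgments. -/
def QuorumCorrect (i : Fin N) : Prop :=
  ∀ a, R.CallsQrm i a → ∃ b, a < b ∧ R.act b = .ret i ∧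
    (∀ p, a < p → p < b → R.act p ≠ .ret i) ∧
    ∃ Q : Finset (Fin N), IsQuorum k e Q ∧ ∀ j ∈ Q, R.Served i j a b

/-- The execution is legal with respect to the gossip and quorum services. (That a node runs at most
one client, which calls `qrmAccess` sequentially, and that servers acknowledge every request holds
by construction of the steps.) -/
def Legal : Prop :=
  (∀ i j, i ≠ j → R.GossipCorrect i j) ∧ ∀ i, R.QuorumCorrect i

/-! ### Asynchronous cycles -/

/-- The steps `m, …, n - 1` include a complete iteration of the server at `i`: it gets a gossip
message from another server, afterwards it sends a message to every other server `j`, which `j`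
receives, and a message that `j` sends thereafter arrives back at `i`. -/
def ServerIteration (i : Fin N) (m n : ℕ) : Prop :=
  ∃ a, m ≤ a ∧ (∃ l g, l ≠ i ∧ R.DeliversGossip l i g a) ∧
    ∀ j, j ≠ i → ∃ b b' d d', a < b ∧ R.act b = .gossipSend i j ∧ R.ReceivedAt i j b b' ∧
      b' < d ∧ R.act d = .gossipSend j i ∧ R.ReceivedAt j i d d' ∧ d' < n

/-- In the steps `m, …, n - 1` every server has a complete iteration, and every node that runs a
client completes at least one client round. -/
def Covers (m n : ℕ) : Prop :=
  (∀ i, R.ServerIteration i m n) ∧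
  ∀ i, (∃ p, m ≤ p ∧ p < n ∧ (R.st p).client i ≠ .idle) →
    ∃ q, m ≤ q ∧ q < n ∧ R.act q = .ret i

/-- The first asynchronous cycle of the suffix that starts in state `m` ends in state `n`. -/
def IsCycle (m n : ℕ) : Prop :=
  m ≤ n ∧ R.Covers m n ∧ ∀ n', m ≤ n' → n' < n → ¬ R.Covers m n'

/-- The first `C` asynchronous cycles of the suffix that starts in state `m` end in state `n`. -/
def CyclesEnd (m : ℕ) : ℕ → ℕ → Prop
  | 0, n => n = m
  | C + 1, n => ∃ n', CyclesEnd m C n' ∧ R.IsCycle n' n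

/-- State `n` is reached within `C` asynchronous cycles (which do come to an end) of the suffix that
starts in state `m`. -/
def WithinCycles (m C n : ℕ) : Prop :=
  ∃ n', R.CyclesEnd m C n' ∧ m ≤ n ∧ n ≤ n'

/-! ### Operations -/

/-- The operation `(i, b)`, which the client at `i` runs from state `b` on, is on-going in state `n`.
If `0 < b`, then `c_{b-1}` is its starting system state and the step that follows executes the first
line of its procedure; if `b = 0`, the client is running already in the starting state of the
execution, and the operation is incomplete. -/
def Ongoing (i : Fin N) (b n : ℕ) : Prop :=
  b ≤ n ∧ (∀ p, b ≤ p → p ≤ n → (R.st p).client i ≠ .idle) ∧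
    (b = 0 ∨ (R.st (b - 1)).client i = .idle)

/-- Step `n` belongs to the operation `(i, b)`: it is its invocation or another step of its client,
or a server receives a request of the operation (and replies), or the client receives a reply to
such a request. Client requests of `i` and replies to `i` that are in transit in the starting state
count as part of the incomplete operation `(i, 0)`. -/
inductive OpStep (i : Fin N) (b : ℕ) : ℕ → Prop
  | invocation (n : ℕ) : b = n + 1 → R.Ongoing i b b → OpStep i b n
  | client (n : ℕ) : R.Ongoing i b n →
      ((∃ j, R.act n = .requestSend i j) ∨ R.act n = .localAccess i ∨ R.act n = .ret i) →
      OpStep i b n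
  | initialRequest (n : ℕ) (j : Fin N) (q : Request N Word) : b = 0 → R.ReceivesInitial i j n →
      ((R.st n).chan i j).head? = some (.request q) → OpStep i b n
  | initialReply (n : ℕ) (j : Fin N) (q : Request N Word) (a : Reply N Word) : b = 0 →
      R.ReceivesInitial j i n → ((R.st n).chan j i).head? = some (.ack q a) → OpStep i b n
  | request (s n : ℕ) (j : Fin N) : OpStep i b s → R.act s = .requestSend i j →
      R.ReceivedAt i j s n → OpStep i b n
  | reply (s n : ℕ) (j : Fin N) : OpStep i b s → R.act s = .recv i j →
      R.ReceivedAt j i s n → OpStep i b n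

/-- The suffix that starts in state `m` includes (a part of) the operation `(i, b)`. -/
def SuffixIncludes (m : ℕ) (i : Fin N) (b : ℕ) : Prop :=
  ∃ n, m ≤ n ∧ (R.Ongoing i b n ∨ R.OpStep i b n)

/-- The operation `(i, b)` is a write operation. -/
def IsWriteOp (i : Fin N) (b : ℕ) : Prop :=
  R.Ongoing i b b ∧ ∃ r acks, (R.st b).client i = .busy r acks ∧ r.IsWrite

/-- The operation `(i, b)` starts with the first line and ends with the last line of its
procedure. -/
def Complete (i : Fin N) (b : ℕ) : Prop :=
  b ≠ 0 ∧ ∃ n, R.Ongoing i b n ∧ R.act n = .ret i ∧ (R.st (n + 1)).client i = .idle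

/-- `t` is the tag of the write operation `(i, b)`, which it uses in its pre-write. -/
def WriteTag (i : Fin N) (b : ℕ) (t : Tag N) : Prop :=
  ∃ n s acks, R.Ongoing i b n ∧ (R.st n).client i = .busy (.wPre s t) acks

/-- The write operation `(i, b)` is valid: it is complete, and there is a system state, before its
starting system state `c_{b-1}`, such that its tag exceeds every tag that appears both in that state
and in the starting state of the execution. -/
def ValidWrite (i : Fin N) (b : ℕ) : Prop :=
  R.Complete i b ∧ ∃ t, R.WriteTag i b t ∧
    ∃ p, p + 1 < b ∧ ∀ t' ∈ (R.st 0).tags ∩ (R.st p).tags, t' < t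

end Execution

end Steps

end

end CAS

namespace CAS

open scoped Classical

/-! ### Tags in the storage of a server -/

section Server

variable {N : ℕ} {Word : Type v}

/-! The proof counts asynchronous cycles, which all come to an end by fairness and legality
(`exists_isCycle`). Two facts drive it. A cycle flushes every channel: some gossip message is sent
and received on the channel within the cycle, and by the FIFO order all that the channel held at the
beginning of the cycle has left before (`Covers.entered_le_received`). And a client that runs
throughout a cycle completes a round in it (`Covers.rank_lt`), while no operation has more than four
rounds. So an operation that starts by the end of cycle `t` is over four cycles later; its last
requests arrive within one more cycle, and the replies within another (`lt_of_opStep`). For `t = 0`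
this disposes of the incomplete operations; for `t = 6` it shows that after twelve cycles only
operations that start after the sixth are left.

The validity of such a write is witnessed by the state after three cycles. Servers never forget a
tag. Three cycles replace the gossip variables, the messages and the collected acknowledgments of
the arbitrary starting state, so that each tag then in the system is `⊥`, is stored, or belongs to a
client round or to a request in transit; in the last two cases a server stores it during the fourth
cycle (`tags_subset`). In the fifth cycle gossip brings every server a tag at least as large
(`Covers.le_maxPhase`), and the sixth flushes the query replies computed earlier (`le_queryAck`). A
writer that starts later sees only such large tags and chooses a larger one (`validWrite`). As all
servers are up to date by then, a single acknowledgment suffices, and no intersection of quorums is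
needed. -/

/-- The tags of the records of a storage. -/
def storeTags (S : Finset (Record N Word)) : Set (Tag N) := {t | ∃ s ∈ S, s.tag = t}

/-- Only records with the tag `t` are removed, and a record with this tag is inserted at once. Hence
no tag is ever lost, although words and phases may be. -/
theorem UpdatePhase.mem_storeTags {S S' : Finset (Record N Word)} {t : Tag N} {w : Option Word}
    {d : Phase} (h : UpdatePhase S t w d S') {u : Tag N} :
    u ∈ storeTags S' ↔ u ∈ storeTags S ∨ u = t := by
  rcases h with ⟨s, hs, hst, -, -, rfl⟩ | ⟨-, rfl⟩
  · constructor
    · rintro ⟨x, hx, rfl⟩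
      rcases Finset.mem_insert.1 hx with rfl | hx
      · exact Or.inr rfl
      · exact Or.inl ⟨x, Finset.mem_of_mem_erase hx, rfl⟩
    · rintro (⟨x, hx, rfl⟩ | rfl)
      · by_cases hxs : x = s
        · exact ⟨_, Finset.mem_insert_self _ _, by rw [hxs]; exact hst.symm⟩
        · exact ⟨x, Finset.mem_insert_of_mem (Finset.mem_erase.2 ⟨hxs, hx⟩), rfl⟩
      · exact ⟨_, Finset.mem_insert_self _ _, rfl⟩
  · constructor
    · rintro ⟨x, hx, rfl⟩
      rcases Finset.mem_insert.1 hx with rfl | hx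
      · exact Or.inr rfl
      · exact Or.inl ⟨x, (Finset.mem_filter.1 hx).1, rfl⟩
    · rintro (⟨x, hx, rfl⟩ | rfl)
      · by_cases hxt : x.tag = t
        · exact ⟨_, Finset.mem_insert_self _ _, hxt.symm⟩
        · exact ⟨x, Finset.mem_insert_of_mem (Finset.mem_filter.2 ⟨hx, hxt⟩), rfl⟩
      · exact ⟨_, Finset.mem_insert_self _ _, rfl⟩

theorem exists_updatePhase (S : Finset (Record N Word)) (t : Tag N) (w : Option Word)
    (d : Phase) : ∃ S', UpdatePhase S t w d S' := by
  by_cases h : ∃ s ∈ S, s.tag = t ∧ s.word ≠ none ∧ w = none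
  · obtain ⟨s, hs, h1, h2, h3⟩ := h
    exact ⟨_, Or.inl ⟨s, hs, h1, h2, h3, rfl⟩⟩
  · exact ⟨_, Or.inr ⟨h, rfl⟩⟩

theorem exists_finReply (corrupt : Prop) (S : Finset (Record N Word)) (r : Role) (t : Tag N)
    (d : Phase) : ∃ a, FinReply corrupt S r t d a := by
  cases r with
  | writer => exact ⟨⟨t, none⟩, rfl, rfl⟩
  | reader =>
    by_cases h : ∃ s ∈ S, s.tag = t ∧ s.phase = d
    · obtain ⟨s, hs, h1, h2⟩ := h
      exact ⟨⟨t, s.word⟩, rfl, Or.inr (Or.inl ⟨s, hs, h1, h2, rfl⟩)⟩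
    · exact ⟨⟨t, none⟩, rfl, Or.inr (Or.inr ⟨h, rfl⟩)⟩

variable [NeZero N]

theorem maxPhase_eq_bot_or_mem (S : Finset (Record N Word)) (D : Set Phase) :
    maxPhase S D = ⊥ ∨ maxPhase S D ∈ storeTags S := by
  rcases (S.filter fun s => s.phase ∈ D).eq_empty_or_nonempty with h | h
  · left
    rw [maxPhase, h, Finset.sup_empty]
  · right
    obtain ⟨s, hs, h⟩ := Finset.exists_mem_eq_sup _ h Record.tag
    exact ⟨s, (Finset.mem_filter.1 hs).1, h.symm⟩

theorem le_maxPhase_univ {S : Finset (Record N Word)} {t : Tag N} (h : t ∈ storeTags S) :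
    t ≤ maxPhase S Set.univ := by
  obtain ⟨s, hs, rfl⟩ := h
  refine Finset.le_sup (f := Record.tag) ?_
  simpa using hs

theorem maxPhase_univ_mono {S S' : Finset (Record N Word)} (h : storeTags S ⊆ storeTags S') :
    maxPhase S Set.univ ≤ maxPhase S' Set.univ := by
  rcases maxPhase_eq_bot_or_mem S Set.univ with h' | h'
  · rw [h']
    exact bot_le
  · exact le_maxPhase_univ (h h')

theorem tagTuple_tags {S : Finset (Record N Word)} {t : Tag N} (h : t ∈ (tagTuple S).tags) :
    t = ⊥ ∨ t ∈ storeTags S := by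
  rcases h with rfl | rfl | rfl <;> exact maxPhase_eq_bot_or_mem _ _

/-- A server can always answer, so that the local access of a running client is applicable and
fairness can be used for it. -/
theorem exists_serve (corrupt : Prop) (S : Finset (Record N Word)) (q : Request N Word) :
    ∃ S' a, Serve corrupt S q S' a := by
  cases q with
  | qry r => cases r <;> exact ⟨_, _, rfl, rfl⟩
  | pre t w =>
    obtain ⟨S', h⟩ := exists_updatePhase S t w .pre
    exact ⟨S', _, h, rfl⟩
  | fin r t =>
    obtain ⟨S', h⟩ := exists_updatePhase S t none .fin
    obtain ⟨a, ha⟩ := exists_finReply corrupt S' r t .fin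
    exact ⟨S', a, h, ha⟩
  | FIN r t =>
    obtain ⟨S', h⟩ := exists_updatePhase S t none .FIN
    obtain ⟨a, ha⟩ := exists_finReply corrupt S' r t .FIN
    exact ⟨S', a, h, ha⟩

namespace Serve

variable {corrupt : Prop} {S S' : Finset (Record N Word)} {q : Request N Word} {a : Reply N Word}

theorem storeTags_subset (h : Serve corrupt S q S' a) : storeTags S ⊆ storeTags S' := by
  cases q with
  | qry r => cases r <;> exact h.1 ▸ subset_rfl
  | pre t w => exact fun u hu => h.1.mem_storeTags.2 (Or.inl hu)
  | fin r t => exact fun u hu => h.1.mem_storeTags.2 (Or.inl hu)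
  | FIN r t => exact fun u hu => h.1.mem_storeTags.2 (Or.inl hu)

theorem request_tags_subset (h : Serve corrupt S q S' a) : q.tags ⊆ storeTags S' := by
  cases q with
  | qry r => exact Set.empty_subset _
  | pre t w => exact fun u hu => h.1.mem_storeTags.2 (Or.inr hu)
  | fin r t => exact fun u hu => h.1.mem_storeTags.2 (Or.inr hu)
  | FIN r t => exact fun u hu => h.1.mem_storeTags.2 (Or.inr hu)

theorem reply_tag (h : Serve corrupt S q S' a) : a.tag = ⊥ ∨ a.tag ∈ storeTags S' := by
  cases q with
  | qry r =>
    cases r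
    · obtain ⟨rfl, rfl⟩ := h
      exact maxPhase_eq_bot_or_mem _ _
    · obtain ⟨rfl, rfl⟩ := h
      exact maxPhase_eq_bot_or_mem _ _
  | pre t w =>
    obtain ⟨h, rfl⟩ := h
    exact Or.inr (h.mem_storeTags.2 (Or.inr rfl))
  | fin r t => exact Or.inr (h.1.mem_storeTags.2 (Or.inr h.2.1))
  | FIN r t => exact Or.inr (h.1.mem_storeTags.2 (Or.inr h.2.1))

end Serve

namespace GossipUpdate

variable {k e : ℕ} {i : Fin N} {g : Fin N → Triple N} {S S' : Finset (Record N Word)}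
  {m : Triple N}

/-- Each of the three aggregated tags is itself written to the storage, so the server's own gossip
entry holds stored tags only, whatever was received. -/
theorem mem_storeTags (h : GossipUpdate k e i g S S' m) {u : Tag N} :
    u ∈ storeTags S' ↔ u ∈ storeTags S ∨ u ∈ m.tags := by
  obtain ⟨S₁, S₂, -, h₁, -, h₂, -, h₃⟩ := h
  rw [h₃.mem_storeTags, h₂.mem_storeTags, h₁.mem_storeTags, or_assoc, or_assoc]
  rfl

theorem le_pre (h : GossipUpdate k e i g S S' m) (l : Fin N) : (g l).pre ≤ m.pre := by
  obtain ⟨S₁, S₂, h₁, -⟩ := h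
  rw [h₁]
  exact le_sup_of_le_left ((le_sup_left.trans le_sup_left).trans
    (Finset.le_sup (f := fun l => (g l).pre ⊔ (g l).fin ⊔ (g l).FIN) (Finset.mem_univ l)))

end GossipUpdate

end Server

/-! ### The effect of a step on the components of the state -/

section Steps

theorem setChan_same {N : ℕ} {α : Type v} (ch : Fin N → Fin N → α) (i j : Fin N) (l : α) :
    setChan ch i j l i j = l := by
  simp [setChan]

theorem setChan_of_ne {N : ℕ} {α : Type v} (ch : Fin N → Fin N → α) {i j i' j' : Fin N} (l : α)
    (h : i' = i → j' ≠ j) : setChan ch i j l i' j' = ch i' j' := by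
  by_cases hi : i' = i
  · subst hi
    simp [setChan, h rfl]
  · simp [setChan, hi]

variable {N k e : ℕ} [NeZero N] {Sec : Type u} {Word : Type v} {P : Setup N k e Sec Word}

/-- The messages that the node `i` may send to `j` in a step from `c` to `c'`. -/
inductive Sends (P : Setup N k e Sec Word) (i j : Fin N) (c c' : State N Sec Word) :
    Msg N Word → Prop
  | gossip : Sends P i j c c' (.gossip (c.gossipTx i))
  | request (r : Round N Sec) (acks : Fin N → Option (Reply N Word)) :
      c.client i = .busy r acks → Sends P i j c c' (.request (r.request P j))
  | ack (q : Request N Word) (a : Reply N Word) :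
      Serve (i ∈ P.corrupt) (c.store i) q (c'.store i) a → Sends P i j c c' (.ack q a)

namespace Step

variable {c c' : State N Sec Word} {x : Action N Sec} {i j : Fin N}

/-- The only access to channels below: a step either pops the head or appends messages whose origin
`Sends` records. -/
theorem chan_cases (h : Step P c x c') (hij : i ≠ j) :
    (x = .recv i j ∧ ∃ m, c.chan i j = m :: c'.chan i j) ∨
    (x ≠ .recv i j ∧ ∃ l, c'.chan i j = c.chan i j ++ l ∧ ∀ m ∈ l, Sends P i j c c' m) := by
  have unchanged : x ≠ .recv i j → c'.chan i j = c.chan i j →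
      (x = .recv i j ∧ ∃ m, c.chan i j = m :: c'.chan i j) ∨
      (x ≠ .recv i j ∧ ∃ l, c'.chan i j = c.chan i j ++ l ∧ ∀ m ∈ l, Sends P i j c c' m) :=
    fun h1 h2 => Or.inr ⟨h1, [], by simp [h2], by simp⟩
  cases x with
  | invokeWrite i' s => obtain ⟨-, rfl⟩ := h; exact unchanged (by simp) rfl
  | invokeRead i' => obtain ⟨-, rfl⟩ := h; exact unchanged (by simp) rfl
  | requestSend i' j' =>
    obtain ⟨-, r, acks, hc, rfl⟩ := h
    by_cases he : i = i' ∧ j = j'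
    · obtain ⟨rfl, rfl⟩ := he
      refine Or.inr ⟨by simp, _, setChan_same _ _ _ _, ?_⟩
      simp only [List.mem_singleton, forall_eq]
      exact .request r acks hc
    · exact unchanged (by simp) (setChan_of_ne _ _ fun h1 h2 => he ⟨h1, h2⟩)
  | localAccess i' =>
    obtain ⟨r, acks, -, S', a, -, rfl⟩ := h
    exact unchanged (by simp) rfl
  | ret i' =>
    obtain ⟨r, acks, -, -, rfl⟩ := h
    exact unchanged (by simp) rfl
  | gossipSend i' j' =>
    obtain ⟨-, rfl⟩ := h
    by_cases he : i = i' ∧ j = j'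
    · obtain ⟨rfl, rfl⟩ := he
      refine Or.inr ⟨by simp, _, setChan_same _ _ _ _, ?_⟩
      simp only [List.mem_singleton, forall_eq]
      exact .gossip
    · exact unchanged (by simp) (setChan_of_ne _ _ fun h1 h2 => he ⟨h1, h2⟩)
  | recv i' j' =>
    obtain ⟨hij', m, l, hm, h⟩ := h
    by_cases he : i = i' ∧ j = j'
    · obtain ⟨rfl, rfl⟩ := he
      refine Or.inl ⟨rfl, m, ?_⟩
      rw [hm]
      cases m with
      | gossip g =>
        obtain ⟨S', m', -, rfl⟩ := h
        simp [setChan_same]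
      | request q =>
        obtain ⟨S', a, -, rfl⟩ := h
        simp only
        rw [setChan_of_ne _ _ fun h => (hij h).elim, setChan_same]
      | ack q a =>
        obtain rfl := h
        simp [setChan_same]
    · have he' : (Action.recv i' j' : Action N Sec) ≠ .recv i j := by
        simp only [ne_eq, Action.recv.injEq]
        exact fun h => he ⟨h.1.symm, h.2.symm⟩
      cases m with
      | gossip g =>
        obtain ⟨S', m', -, rfl⟩ := h
        exact unchanged he' (setChan_of_ne _ _ fun h1 h2 => he ⟨h1, h2⟩)
      | request q =>
        obtain ⟨S', a, hs, rfl⟩ := h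
        by_cases hr : i = j' ∧ j = i'
        · obtain ⟨rfl, rfl⟩ := hr
          refine Or.inr ⟨he', _, setChan_same _ _ _ _, ?_⟩
          simp only [List.mem_singleton, forall_eq]
          refine .ack q a ?_
          simpa using hs
        · refine unchanged he' ?_
          simp only
          rw [setChan_of_ne _ _ fun h1 h2 => hr ⟨h1, h2⟩,
            setChan_of_ne _ _ fun h1 h2 => he ⟨h1, h2⟩]
      | ack q a =>
        obtain rfl := h
        exact unchanged he' (setChan_of_ne _ _ fun h1 h2 => he ⟨h1, h2⟩)

theorem recv_ne (h : Step P c (.recv i j) c') : i ≠ j := h.1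

theorem recv_gossip (h : Step P c (.recv i j) c') {g : Triple N} {l : List (Msg N Word)}
    (hc : c.chan i j = .gossip g :: l) :
    ∃ m, GossipUpdate k e j (Function.update (c.gossip j) i g) (c.store j) (c'.store j) m ∧
      c'.gossip j = Function.update (Function.update (c.gossip j) i g) j m ∧
      c'.gossipTx j = tagTuple (c'.store j) := by
  obtain ⟨-, m, l', hm, h⟩ := h
  obtain ⟨rfl, -⟩ := List.cons.inj (hc.symm.trans hm)
  obtain ⟨S', m', hg, rfl⟩ := h
  exact ⟨m', by simpa using hg, by simp, by simp⟩

theorem recv_request (h : Step P c (.recv i j) c') {q : Request N Word} {l : List (Msg N Word)}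
    (hc : c.chan i j = .request q :: l) :
    (∃ a, c'.chan j i = c.chan j i ++ [.ack q a]) ∧ q.tags ⊆ storeTags (c'.store j) := by
  obtain ⟨-, m, l', hm, h⟩ := h
  obtain ⟨rfl, -⟩ := List.cons.inj (hc.symm.trans hm)
  obtain ⟨S', a, hs, rfl⟩ := h
  exact ⟨⟨a, setChan_same _ _ _ _⟩, by simpa using hs.request_tags_subset⟩

theorem recv_ack (h : Step P c (.recv j i) c') {r : Round N Sec}
    {acks : Fin N → Option (Reply N Word)} {a : Reply N Word} {l : List (Msg N Word)}
    (hc : c.chan j i = .ack (r.request P j) a :: l) (hb : c.client i = .busy r acks) :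
    c'.client i = .busy r (Function.update acks j (some a)) := by
  obtain ⟨-, m, l', hm, h⟩ := h
  obtain ⟨rfl, -⟩ := List.cons.inj (hc.symm.trans hm)
  obtain rfl := h
  simp [hb, collect]

theorem storeTags_subset (h : Step P c x c') (i : Fin N) :
    storeTags (c.store i) ⊆ storeTags (c'.store i) := by
  cases x with
  | invokeWrite i' s => obtain ⟨-, rfl⟩ := h; exact subset_rfl
  | invokeRead i' => obtain ⟨-, rfl⟩ := h; exact subset_rfl
  | requestSend i' j' => obtain ⟨-, r, acks, hc, rfl⟩ := h; exact subset_rfl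
  | localAccess i' =>
    obtain ⟨r, acks, -, S', a, hs, rfl⟩ := h
    by_cases hi : i = i'
    · subst hi
      simpa using hs.storeTags_subset
    · simp [hi]
  | ret i' => obtain ⟨r, acks, -, -, rfl⟩ := h; exact subset_rfl
  | gossipSend i' j' => obtain ⟨-, rfl⟩ := h; exact subset_rfl
  | recv i' j =>
    obtain ⟨-, m, l, -, h⟩ := h
    cases m with
    | gossip g =>
      obtain ⟨S', m', hs, rfl⟩ := h
      by_cases hi : i = j
      · subst hi
        have hsub : storeTags (c.store i) ⊆ storeTags S' :=
          fun u hu => hs.mem_storeTags.2 (Or.inl hu)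
        simpa using hsub
      · simp [hi]
    | request q =>
      obtain ⟨S', a, hs, rfl⟩ := h
      by_cases hi : i = j
      · subst hi
        simpa using hs.storeTags_subset
      · simp [hi]
    | ack q a => obtain rfl := h; exact subset_rfl

/-- The gossip variables of a server change only when it receives gossip. -/
theorem gossip_cases (h : Step P c x c') (j : Fin N) :
    (c'.gossip j = c.gossip j ∧ c'.gossipTx j = c.gossipTx j) ∨
      ∃ i g l, x = .recv i j ∧ c.chan i j = .gossip g :: l := by
  cases x with
  | invokeWrite i' s => obtain ⟨-, rfl⟩ := h; exact Or.inl ⟨rfl, rfl⟩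
  | invokeRead i' => obtain ⟨-, rfl⟩ := h; exact Or.inl ⟨rfl, rfl⟩
  | requestSend i' j' => obtain ⟨-, r, acks, hc, rfl⟩ := h; exact Or.inl ⟨rfl, rfl⟩
  | localAccess i' => obtain ⟨r, acks, -, S', a, hs, rfl⟩ := h; exact Or.inl ⟨rfl, rfl⟩
  | ret i' => obtain ⟨r, acks, -, -, rfl⟩ := h; exact Or.inl ⟨rfl, rfl⟩
  | gossipSend i' j' => obtain ⟨-, rfl⟩ := h; exact Or.inl ⟨rfl, rfl⟩
  | recv i' j' =>
    obtain ⟨-, m, l, hm, h⟩ := h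
    cases m with
    | gossip g =>
      by_cases hj : j = j'
      · subst hj
        exact Or.inr ⟨i', g, l, rfl, hm⟩
      · obtain ⟨S', m', hs, rfl⟩ := h
        simp [hj]
    | request q => obtain ⟨S', a, hs, rfl⟩ := h; exact Or.inl ⟨rfl, rfl⟩
    | ack q a => obtain rfl := h; exact Or.inl ⟨rfl, rfl⟩

/-- A client that neither starts nor returns from a call keeps its round, and the acknowledgments
that it collects come from a channel or from its own server. -/
def ClientKeeps (P : Setup N k e Sec Word) (c c' : State N Sec Word) (i : Fin N) : Prop :=
  ∃ r acks acks', c.client i = .busy r acks ∧ c'.client i = .busy r acks' ∧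
    (∀ j, acks j ≠ none → acks' j ≠ none) ∧
    ∀ j a, acks' j = some a → acks j = some a ∨
      (j ≠ i ∧ .ack (r.request P j) a ∈ c.chan j i) ∨
      Serve (i ∈ P.corrupt) (c.store i) (r.request P i) (c'.store i) a

theorem clientKeeps_of_eq {r : Round N Sec} {acks : Fin N → Option (Reply N Word)}
    (h : c.client i = .busy r acks) (h' : c'.client i = c.client i) : ClientKeeps P c c' i :=
  ⟨r, acks, acks, h, h'.trans h, fun _ => id, fun _ _ h => Or.inl h⟩

/-- A running client can become idle or change its round only by a return, and an idle one can start
only with a query that has no acknowledgments yet. -/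
theorem client_cases (h : Step P c x c') (i : Fin N) :
    (c.client i = .idle ∧ (c'.client i = .idle ∨
      (∃ s, c'.client i = .busy (.wQry s) fun _ => none) ∨
      c'.client i = .busy .rQry fun _ => none)) ∨
    (x = .ret i ∧ ∃ r acks, c.client i = .busy r acks ∧
      IsQuorum k e (Finset.univ.filter fun j => acks j ≠ none) ∧
      c'.client i = nextClient i r acks) ∨
    (x ≠ .ret i ∧ ClientKeeps P c c' i) := by
  have unchanged : x ≠ .ret i → c'.client i = c.client i →
      (c.client i = .idle ∧ (c'.client i = .idle ∨
        (∃ s, c'.client i = .busy (.wQry s) fun _ => none) ∨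
        c'.client i = .busy .rQry fun _ => none)) ∨
      (x = .ret i ∧ ∃ r acks, c.client i = .busy r acks ∧
        IsQuorum k e (Finset.univ.filter fun j => acks j ≠ none) ∧
        c'.client i = nextClient i r acks) ∨
      (x ≠ .ret i ∧ ClientKeeps P c c' i) := by
    intro h1 h2
    cases hc : c.client i with
    | idle => exact Or.inl ⟨rfl, Or.inl (h2.trans hc)⟩
    | busy r acks => exact Or.inr (Or.inr ⟨h1, clientKeeps_of_eq hc h2⟩)
  cases x with
  | invokeWrite i' s =>
    obtain ⟨hc, rfl⟩ := h
    by_cases hi : i = i'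
    · subst hi
      exact Or.inl ⟨hc, Or.inr (Or.inl ⟨s, by simp⟩)⟩
    · exact unchanged (by simp) (by simp [hi])
  | invokeRead i' =>
    obtain ⟨hc, rfl⟩ := h
    by_cases hi : i = i'
    · subst hi
      exact Or.inl ⟨hc, Or.inr (Or.inr (by simp))⟩
    · exact unchanged (by simp) (by simp [hi])
  | requestSend i' j' =>
    obtain ⟨-, r, acks, -, rfl⟩ := h
    exact unchanged (by simp) rfl
  | localAccess i' =>
    obtain ⟨r, acks, hc, S', a, hs, rfl⟩ := h
    by_cases hi : i = i'
    · subst hi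
      refine Or.inr (Or.inr ⟨by simp, r, acks, _, hc, by simp; rfl, fun j hj => ?_,
        fun j a' hj => ?_⟩)
      · by_cases hji : j = i
        · simp [hji]
        · simpa [hji] using hj
      · by_cases hji : j = i
        · subst hji
          obtain rfl : a = a' := by simpa using hj
          exact Or.inr (Or.inr (by simpa using hs))
        · exact Or.inl (by simpa [hji] using hj)
    · exact unchanged (by simp) (by simp [hi])
  | ret i' =>
    obtain ⟨r, acks, hc, hq, rfl⟩ := h
    by_cases hi : i = i'
    · subst hi
      exact Or.inr (Or.inl ⟨rfl, r, acks, hc, hq, by simp⟩)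
    · exact unchanged (by simpa using fun h => hi h.symm) (by simp [hi])
  | gossipSend i' j' =>
    obtain ⟨-, rfl⟩ := h
    exact unchanged (by simp) rfl
  | recv i' j' =>
    obtain ⟨hij, m, l, hm, h⟩ := h
    cases m with
    | gossip g =>
      obtain ⟨S', m', hs, rfl⟩ := h
      exact unchanged (by simp) rfl
    | request q =>
      obtain ⟨S', a, hs, rfl⟩ := h
      exact unchanged (by simp) rfl
    | ack q a =>
      obtain rfl := h
      by_cases hi : i = j'
      · subst hi
        cases hc : c.client i with
        | idle => exact Or.inl ⟨rfl, Or.inl (by simp [collect])⟩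
        | busy r acks =>
          by_cases hq : r.request P i' = q
          · refine Or.inr (Or.inr ⟨by simp, r, acks, _, hc, by simp [collect, hq]; rfl,
              fun j hj => ?_, fun j a' hj => ?_⟩)
            · by_cases hji : j = i'
              · simp [hji]
              · simpa [hji] using hj
            · by_cases hji : j = i'
              · subst hji
                obtain rfl : a = a' := by simpa using hj
                exact Or.inr (Or.inl ⟨hij, by simp [hm, hq]⟩)
              · exact Or.inl (by simpa [hji] using hj)
          · exact Or.inr (Or.inr ⟨by simp, clientKeeps_of_eq hc (by simp [collect, hq, hc])⟩)
      · exact unchanged (by simp) (by simp [hi])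

end Step

end Steps

namespace Execution

variable {N k e : ℕ} [NeZero N] {Sec : Type u} {Word : Type v} {P : Setup N k e Sec Word}
  (R : Execution P)

/-! ### Channels as FIFO queues -/

/-- The number of messages that have left the channel from `i` to `j` before state `n`. -/
noncomputable def received (i j : Fin N) (n : ℕ) : ℕ :=
  ((Finset.range n).filter fun p => R.act p = .recv i j).card

/-- The number of messages that have entered the channel from `i` to `j` before state `n`,
including those of the starting state. -/
noncomputable def entered (i j : Fin N) (n : ℕ) : ℕ := R.received i j n + ((R.st n).chan i j).length

variable {R} {i j : Fin N} {m n : ℕ}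

theorem received_succ_of_eq (h : R.act n = .recv i j) :
    R.received i j (n + 1) = R.received i j n + 1 := by
  simp [received, Finset.range_add_one, Finset.filter_insert, h]

theorem received_succ_of_ne (h : R.act n ≠ .recv i j) :
    R.received i j (n + 1) = R.received i j n := by
  simp [received, Finset.range_add_one, Finset.filter_insert, h]

theorem received_mono (h : m ≤ n) : R.received i j m ≤ R.received i j n :=
  Finset.card_le_card (Finset.filter_subset_filter _ (Finset.range_mono h))

theorem received_add_card (h : m < n) : R.received i j (m + 1) +
    ((Finset.Ioo m n).filter fun p => R.act p = .recv i j).card = R.received i j n := by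
  rw [received, received, ← Finset.card_union_of_disjoint, ← Finset.filter_union]
  · congr 2
    ext p
    simp only [Finset.mem_union, Finset.mem_range, Finset.mem_Ioo]
    omega
  · refine Finset.disjoint_filter_filter (Finset.disjoint_left.2 fun p hp hp' => ?_)
    simp only [Finset.mem_range, Finset.mem_Ioo] at hp hp'
    omega

/-- If the messages of a channel are numbered in FIFO order, the one that step `s` appends has the
number `entered (s + 1)`, and step `d` removes the one with the number `received d + 1`. -/
theorem receivedAt_iff {s d : ℕ} : R.ReceivedAt i j s d ↔
    s < d ∧ R.act d = .recv i j ∧ R.received i j d + 1 = R.entered i j (s + 1) := by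
  refine and_congr_right fun h => and_congr_right fun _ => ?_
  rw [← received_add_card h, entered]
  omega

theorem entered_succ_le (hij : i ≠ j) (n : ℕ) : R.entered i j n ≤ R.entered i j (n + 1) := by
  unfold entered
  rcases (R.step n).chan_cases hij with ⟨hx, x, hc⟩ | ⟨hx, l, hc, -⟩
  · rw [hc, received_succ_of_eq hx, List.length_cons]
    omega
  · rw [hc, received_succ_of_ne hx, List.length_append]
    omega

theorem entered_mono (hij : i ≠ j) (h : m ≤ n) : R.entered i j m ≤ R.entered i j n :=
  monotone_nat_of_le_succ (entered_succ_le hij) h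

/-- The absolute index of a message (its position plus the number of messages already removed) is
invariant as long as it stays in the channel. -/
theorem chan_getElem? (hij : i ≠ j) (hmn : m ≤ n) {t : ℕ} {x : Msg N Word}
    (hx : ((R.st m).chan i j)[t]? = some x) (hr : R.received i j n ≤ R.received i j m + t) :
    ((R.st n).chan i j)[R.received i j m + t - R.received i j n]? = some x := by
  induction n, hmn using Nat.le_induction with
  | base => simpa using hx
  | succ n hmn ih =>
    have ih := ih ((received_mono n.le_succ).trans hr)
    rcases (R.step n).chan_cases hij with ⟨ha, y, hc⟩ | ⟨ha, l, hc, -⟩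
    · rw [received_succ_of_eq ha] at hr ⊢
      rw [hc, show R.received i j m + t - R.received i j n =
        R.received i j m + t - (R.received i j n + 1) + 1 by omega] at ih
      simpa using ih
    · rw [received_succ_of_ne ha, hc, List.getElem?_append_left, ih]
      exact (List.getElem?_eq_some_iff.1 ih).1

theorem head?_of_receivedAt (hij : i ≠ j) {s d : ℕ} (h : R.ReceivedAt i j s d)
    {l : List (Msg N Word)} {x : Msg N Word} (hc : (R.st (s + 1)).chan i j = l ++ [x]) :
    ((R.st d).chan i j).head? = some x := by
  obtain ⟨hsd, -, hr⟩ := receivedAt_iff.1 h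
  have hr' : R.received i j d = R.received i j (s + 1) + l.length := by
    rw [entered, hc, List.length_append, List.length_singleton] at hr
    omega
  have := chan_getElem? hij (show s + 1 ≤ d from hsd) (t := l.length) (x := x) (by simp [hc])
    hr'.le
  rw [hr', Nat.sub_self] at this
  rwa [List.head?_eq_getElem?]

/-- A discrete intermediate value argument: the count of receptions grows by at most one per step.
-/
theorem exists_recv_between {w : ℕ} (hm : R.received i j m ≤ w) (hn : w < R.received i j n) :
    ∃ d, m ≤ d ∧ d < n ∧ R.act d = .recv i j ∧ R.received i j d = w := by
  induction n with
  | zero => simp [received] at hn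
  | succ n ih =>
    by_cases h : w < R.received i j n
    · obtain ⟨d, h1, h2, h3⟩ := ih h
      exact ⟨d, h1, h2.trans n.lt_succ_self, h3⟩
    · by_cases ha : R.act n = .recv i j
      · rw [received_succ_of_eq ha] at hn
        refine ⟨n, ?_, n.lt_succ_self, ha, by omega⟩
        by_contra hlt
        have := received_mono (R := R) (i := i) (j := j) (show n + 1 ≤ m by omega)
        rw [received_succ_of_eq ha] at this
        omega
      · rw [received_succ_of_ne ha] at hn
        exact absurd hn h

theorem exists_recv_of_mem (hij : i ≠ j) {x : Msg N Word} (hx : x ∈ (R.st m).chan i j)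
    (hn : R.entered i j m ≤ R.received i j n) :
    ∃ d, m ≤ d ∧ d < n ∧ R.act d = .recv i j ∧ ((R.st d).chan i j).head? = some x := by
  obtain ⟨t, ht⟩ := List.mem_iff_getElem?.1 hx
  have hlt : t < ((R.st m).chan i j).length := (List.getElem?_eq_some_iff.1 ht).1
  obtain ⟨d, hmd, hdn, hd, hr⟩ := exists_recv_between (R := R) (i := i) (j := j) (m := m) (n := n)
    (w := R.received i j m + t) (Nat.le_add_right _ _) (by unfold entered at hn; omega)
  refine ⟨d, hmd, hdn, hd, ?_⟩
  have := chan_getElem? hij hmd ht hr.le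
  rwa [hr, Nat.sub_self, ← List.head?_eq_getElem?] at this

/-- Once the messages of state `m` have left a channel, it holds only messages sent since. -/
theorem forall_mem_chan (hij : i ≠ j) (hmn : m ≤ n) {p : Msg N Word → Prop}
    (hp : ∀ s, m ≤ s → s < n → ∀ x, Sends P i j (R.st s) (R.st (s + 1)) x → p x)
    (hr : R.entered i j m ≤ R.received i j n) : ∀ x ∈ (R.st n).chan i j, p x := by
  -- Invariant for the induction: the difference counts the messages of state `m` that are still in
  -- front, and truncated subtraction makes it `0` once they are gone.
  have key : ∀ x ∈ ((R.st n).chan i j).drop (R.entered i j m - R.received i j n), p x := by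
    clear hr
    induction n, hmn using Nat.le_induction with
    | base => simp [entered]
    | succ n hmn ih =>
      have ih := ih fun s h1 h2 => hp s h1 (h2.trans n.lt_succ_self)
      rcases (R.step n).chan_cases hij with ⟨ha, y, hc⟩ | ⟨ha, l, hc, hl⟩
      · rw [hc] at ih
        rw [received_succ_of_eq ha]
        intro x hx
        refine ih x ?_
        rcases h : R.entered i j m - R.received i j n with _ | t
        · rw [Nat.sub_add_eq, h] at hx
          exact List.mem_cons_of_mem _ (by simpa using hx)
        · rw [Nat.sub_add_eq, h] at hx
          simpa using hx
      · rw [received_succ_of_ne ha, hc]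
        intro x hx
        rw [List.drop_append, List.mem_append] at hx
        rcases hx with hx | hx
        · exact ih x hx
        · exact hp n hmn n.lt_succ_self x (hl x (List.mem_of_mem_drop hx))
  rwa [Nat.sub_eq_zero_of_le hr, List.drop_zero] at key

/-! ### Every cycle comes to an end -/

theorem Legal.exists_recv (hL : R.Legal) (hij : i ≠ j) (m : ℕ) :
    ∃ n, m ≤ n ∧ R.act n = .recv i j :=
  let ⟨n, _, h, h'⟩ := (hL.1 i j hij).2 m
  ⟨n, h, h'.1⟩

theorem Legal.exists_lt_received (hL : R.Legal) (hij : i ≠ j) (w : ℕ) :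
    ∃ n, w < R.received i j n := by
  induction w with
  | zero =>
    obtain ⟨n, -, hn⟩ := hL.exists_recv hij 0
    exact ⟨n + 1, by rw [received_succ_of_eq hn]; omega⟩
  | succ w ih =>
    obtain ⟨m, hm⟩ := ih
    obtain ⟨n, hmn, hn⟩ := hL.exists_recv hij m
    refine ⟨n + 1, ?_⟩
    have := received_mono (R := R) (i := i) (j := j) hmn
    rw [received_succ_of_eq hn]
    omega

theorem Legal.exists_receivedAt (hL : R.Legal) (hij : i ≠ j) {s : ℕ} {l : List (Msg N Word)}
    {x : Msg N Word} (hc : (R.st (s + 1)).chan i j = l ++ [x]) : ∃ d, R.ReceivedAt i j s d := by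
  have hlen : R.received i j (s + 1) + l.length + 1 = R.entered i j (s + 1) := by
    rw [entered, hc, List.length_append, List.length_singleton, add_assoc]
  obtain ⟨n, hn⟩ := hL.exists_lt_received hij (R.received i j (s + 1) + l.length)
  obtain ⟨d, hsd, -, hd, hr⟩ := exists_recv_between (m := s + 1) (Nat.le_add_right _ _) hn
  exact ⟨d, receivedAt_iff.2 ⟨hsd, hd, by rw [hr, hlen]⟩⟩

theorem chan_of_gossipSend (h : R.act n = .gossipSend i j) :
    (R.st (n + 1)).chan i j = (R.st n).chan i j ++ [.gossip ((R.st n).gossipTx i)] := by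
  have hs := R.step n
  rw [h] at hs
  rw [hs.2]
  exact setChan_same _ _ _ _

theorem Fair.exists_gossipSend (hF : R.Fair) (hij : i ≠ j) (m : ℕ) :
    ∃ n, m ≤ n ∧ R.act n = .gossipSend i j :=
  hF (.gossipSend i j) (by simp [Action.IsInvocation]) (fun m => ⟨m, le_rfl, _, hij, rfl⟩) m

theorem exists_serverIteration (hF : R.Fair) (hL : R.Legal) (hN : 2 ≤ N) (i : Fin N) (m : ℕ) :
    ∃ n₀, ∀ n, n₀ ≤ n → R.ServerIteration i m n := by
  have : Nontrivial (Fin N) := Fin.nontrivial_iff_two_le.2 hN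
  obtain ⟨l, hl⟩ := exists_ne i
  obtain ⟨a, g, hma, hg⟩ := (hL.1 l i hl).2 m
  have h : ∀ j, ∃ n₀, j ≠ i → ∃ b b' d d', a < b ∧ R.act b = .gossipSend i j ∧
      R.ReceivedAt i j b b' ∧ b' < d ∧ R.act d = .gossipSend j i ∧ R.ReceivedAt j i d d' ∧
      d' < n₀ := by
    intro j
    by_cases hj : j = i
    · exact ⟨0, fun h => absurd hj h⟩
    · obtain ⟨b, hab, hb⟩ := hF.exists_gossipSend (Ne.symm hj) (a + 1)
      obtain ⟨b', hb'⟩ := hL.exists_receivedAt (Ne.symm hj) (chan_of_gossipSend hb)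
      obtain ⟨d, hbd, hd⟩ := hF.exists_gossipSend hj (b' + 1)
      obtain ⟨d', hd'⟩ := hL.exists_receivedAt hj (chan_of_gossipSend hd)
      exact ⟨d' + 1, fun _ => ⟨b, b', d, d', hab, hb, hb', hbd, hd, hd', d'.lt_succ_self⟩⟩
  choose f hf using h
  refine ⟨Finset.univ.sup f, fun n hn => ⟨a, hma, ⟨l, g, hl, hg⟩, fun j hj => ?_⟩⟩
  obtain ⟨b, b', d, d', h1, h2, h3, h4, h5, h6, h7⟩ := hf j hj
  exact ⟨b, b', d, d', h1, h2, h3, h4, h5, h6,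
    h7.trans_le ((Finset.le_sup (Finset.mem_univ j)).trans hn)⟩

/-- Between two returns, a running client keeps its round and its acknowledgments. -/
theorem busy_of_forall_ne_ret {r : Round N Sec} {acks : Fin N → Option (Reply N Word)}
    (hmn : m ≤ n) (hm : (R.st m).client i = .busy r acks)
    (h : ∀ p, m ≤ p → p < n → R.act p ≠ .ret i) :
    ∃ acks', (R.st n).client i = .busy r acks' ∧ ∀ j, acks j ≠ none → acks' j ≠ none := by
  induction n, hmn using Nat.le_induction with
  | base => exact ⟨acks, hm, fun _ => id⟩
  | succ n hmn ih =>
    obtain ⟨acks', h1, h2⟩ := ih fun p hp hp' => h p hp (hp'.trans n.lt_succ_self)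
    rcases (R.step n).client_cases i with ⟨hc, -⟩ | ⟨hc, -⟩ | ⟨-, r', b, b', h3, h4, h5, -⟩
    · simp [h1] at hc
    · exact absurd hc (h n hmn n.lt_succ_self)
    · obtain ⟨rfl, rfl⟩ := Client.busy.inj (h1.symm.trans h3)
      exact ⟨b', h4, fun j hj => h5 j (h2 j hj)⟩

/-- A client stuck in a round can transmit its request forever, so by fairness it does; the channels
drain, hence the request arrives and its acknowledgment comes back while the round is still the
same. -/
theorem exists_ack (hF : R.Fair) (hL : R.Legal) {r : Round N Sec}
    (hb : ∀ n, m ≤ n → ∃ acks, (R.st n).client i = .busy r acks) (j : Fin N) :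
    ∃ n acks, m ≤ n ∧ (R.st n).client i = .busy r acks ∧ acks j ≠ none := by
  by_cases hij : i = j
  · subst hij
    obtain ⟨n, hmn, hn⟩ := hF (.localAccess i) (by simp [Action.IsInvocation]) (fun p => by
      obtain ⟨acks, h⟩ := hb (max m p) (le_max_left _ _)
      obtain ⟨S', a, hs⟩ := exists_serve (i ∈ P.corrupt) ((R.st (max m p)).store i)
        (r.request P i)
      exact ⟨_, le_max_right m p, _, r, acks, h, S', a, hs, rfl⟩) m
    have hs := R.step n
    rw [hn] at hs
    obtain ⟨r', acks, hc, S', a, -, hs⟩ := hs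
    obtain ⟨acks', hc'⟩ := hb n hmn
    obtain ⟨rfl, rfl⟩ := Client.busy.inj (hc'.symm.trans hc)
    refine ⟨n + 1, _, hmn.trans n.le_succ, by rw [hs]; exact Function.update_self _ _ _, by simp⟩
  · obtain ⟨s, hms, hs⟩ := hF (.requestSend i j) (by simp [Action.IsInvocation]) (fun p => by
      obtain ⟨acks, h⟩ := hb (max m p) (le_max_left _ _)
      exact ⟨_, le_max_right m p, _, hij, r, acks, h, rfl⟩) m
    have hstep := R.step s
    rw [hs] at hstep
    obtain ⟨-, r', acks, hc, hstep⟩ := hstep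
    obtain ⟨acks', hc'⟩ := hb s hms
    obtain ⟨rfl, -⟩ := Client.busy.inj (hc'.symm.trans hc)
    have hch : (R.st (s + 1)).chan i j = (R.st s).chan i j ++ [.request (r.request P j)] := by
      rw [hstep]
      exact setChan_same _ _ _ _
    obtain ⟨d, hd⟩ := hL.exists_receivedAt hij hch
    obtain ⟨l, hl⟩ := List.head?_eq_some_iff.1 (head?_of_receivedAt hij hd hch)
    obtain ⟨⟨a, ha⟩, -⟩ := (hd.2.1 ▸ R.step d).recv_request hl
    obtain ⟨x, hx⟩ := hL.exists_receivedAt (Ne.symm hij) ha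
    obtain ⟨l', hl'⟩ := List.head?_eq_some_iff.1 (head?_of_receivedAt (Ne.symm hij) hx ha)
    have hmx : m ≤ x := hms.trans (hd.1.le.trans hx.1.le)
    obtain ⟨acks₁, h₁⟩ := hb x hmx
    exact ⟨x + 1, _, hmx.trans x.le_succ, (hx.2.1 ▸ R.step x).recv_ack hl' h₁, by simp⟩

/-- Without a return the client would collect acknowledgments from all servers, which form a quorum
as `k + 2e ≤ N`; returning would then stay applicable, against fairness. This also covers calls
pending in the starting state. -/
theorem exists_ret (hF : R.Fair) (hL : R.Legal) (hk : k + 2 * e ≤ N)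
    (hm : (R.st m).client i ≠ .idle) : ∃ n, m ≤ n ∧ R.act n = .ret i := by
  by_contra hno
  push Not at hno
  cases hc : (R.st m).client i with
  | idle => exact hm hc
  | busy r acks =>
    have hb : ∀ n, m ≤ n → ∃ acks, (R.st n).client i = .busy r acks := fun n hn =>
      let ⟨acks', h, _⟩ := busy_of_forall_ne_ret hn hc fun p hp _ => hno p hp
      ⟨acks', h⟩
    choose f acks' h1 h2 h3 using exists_ack hF hL hb
    refine (hF (.ret i) (by simp [Action.IsInvocation]) (fun p => ?_) m).elim
      fun n hn => hno n hn.1 hn.2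
    -- A state beyond `p` in which the acknowledgments of all servers, held from the states `f j`
    -- on, are present together.
    set q := max p (Finset.univ.sup f ⊔ m)
    obtain ⟨acks, hq⟩ := hb q (le_sup_right.trans (le_max_right _ _))
    refine ⟨q, le_max_left _ _, _, r, acks, hq, ?_, rfl⟩
    have hall : ∀ j, acks j ≠ none := by
      intro j
      obtain ⟨acks'', h, hmono⟩ := busy_of_forall_ne_ret
        (((Finset.le_sup (Finset.mem_univ j)).trans le_sup_left).trans (le_max_right p _) : f j ≤ q)
        (h2 j) fun p hp _ => hno p ((h1 j).trans hp)
      obtain ⟨-, rfl⟩ := Client.busy.inj (h.symm.trans hq)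
      exact hmono j (h3 j)
    rw [IsQuorum, Finset.filter_true_of_mem fun j _ => hall j, Finset.card_univ, Fintype.card_fin]
    omega

theorem exists_isCycle (hF : R.Fair) (hL : R.Legal) (hN : 2 ≤ N) (hk : k + 2 * e ≤ N) (m : ℕ) :
    ∃ n, R.IsCycle m n := by
  choose f hf using fun i => exists_serverIteration hF hL hN i m
  -- A longer prefix may contain further clients, so `Covers` need not be monotone in its end. The
  -- bound therefore allows for every node that runs a client at any time after `m`.
  have h : ∀ i, ∃ n₀, (∃ p, m ≤ p ∧ (R.st p).client i ≠ .idle) →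
      ∃ q, m ≤ q ∧ q < n₀ ∧ R.act q = .ret i := by
    intro i
    by_cases hi : ∃ p, m ≤ p ∧ (R.st p).client i ≠ .idle
    · obtain ⟨p, hp, hp'⟩ := hi
      obtain ⟨q, hq, hq'⟩ := exists_ret hF hL hk hp'
      exact ⟨q + 1, fun _ => ⟨q, hp.trans hq, q.lt_succ_self, hq'⟩⟩
    · exact ⟨0, fun h => absurd h hi⟩
  choose g hg using h
  have hex : ∃ n, m ≤ n ∧ R.Covers m n := by
    refine ⟨m ⊔ Finset.univ.sup f ⊔ Finset.univ.sup g, le_sup_left.trans le_sup_left,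
      fun i => hf i _ ?_, fun i => ?_⟩
    · exact (Finset.le_sup (Finset.mem_univ i)).trans (le_sup_right.trans le_sup_left)
    · rintro ⟨p, hp, -, hp'⟩
      obtain ⟨q, h1, h2, h3⟩ := hg i ⟨p, hp, hp'⟩
      exact ⟨q, h1, h2.trans_le ((Finset.le_sup (Finset.mem_univ i)).trans le_sup_right), h3⟩
  exact ⟨Nat.find hex, (Nat.find_spec hex).1, (Nat.find_spec hex).2,
    fun n' h1 h2 h3 => Nat.find_min hex h2 ⟨h1, h3⟩⟩

end Execution

/-! ### The remaining rounds of a client as a decreasing measure -/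

/-- The number of rounds that a client has still to complete. -/
def Client.rank {N : ℕ} {Sec : Type u} {Word : Type v} : Client N Sec Word → ℕ
  | .idle => 0
  | .busy (.wQry _) _ => 4
  | .busy (.wPre _ _) _ => 3
  | .busy (.wFin _) _ => 2
  | .busy (.wFIN _) _ => 1
  | .busy .rQry _ => 2
  | .busy (.rFin _) _ => 1

theorem Client.rank_le {N : ℕ} {Sec : Type u} {Word : Type v} (c : Client N Sec Word) :
    c.rank ≤ 4 := by
  rcases c with _ | ⟨_ | _ | _ | _ | _ | _, _⟩ <;> simp [Client.rank]

theorem Client.eq_idle_of_rank {N : ℕ} {Sec : Type u} {Word : Type v} {c : Client N Sec Word}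
    (h : c.rank = 0) : c = .idle := by
  rcases c with _ | ⟨_ | _ | _ | _ | _ | _, _⟩ <;> simp_all [Client.rank]

theorem rank_nextClient {N : ℕ} [NeZero N] {Sec : Type u} {Word : Type v} (i : Fin N)
    (r : Round N Sec) (acks : Fin N → Option (Reply N Word)) :
    (nextClient i r acks).rank + 1 = (Client.busy r acks).rank := by
  cases r <;> rfl

theorem Client.rank_busy_eq {N : ℕ} {Sec : Type u} {Word : Type v} (r : Round N Sec)
    (acks acks' : Fin N → Option (Reply N Word)) :
    (Client.busy r acks).rank = (Client.busy r acks').rank := by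
  cases r <;> rfl

namespace Execution

variable {N k e : ℕ} [NeZero N] {Sec : Type u} {Word : Type v} {P : Setup N k e Sec Word}
  {R : Execution P} {i j : Fin N} {m n : ℕ}

/-! ### What happens in a cycle -/

theorem Covers.lt (hC : R.Covers m n) : m < n := by
  obtain ⟨a, ha, ⟨l, g, hl, -⟩, h⟩ := hC.1 0
  obtain ⟨b, b', d, d', h1, -, h2, h3, -, h4, h5⟩ := h l hl
  exact ha.trans_lt (h1.trans (h2.1.trans (h3.trans (h4.1.trans h5))))

theorem Covers.exists_receivedAt (hC : R.Covers m n) (hij : i ≠ j) :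
    ∃ a b d, m ≤ a ∧ (∃ l g, l ≠ i ∧ R.DeliversGossip l i g a) ∧ a < b ∧
      R.act b = .gossipSend i j ∧ R.ReceivedAt i j b d ∧ d < n := by
  obtain ⟨a, ha, hg, h⟩ := hC.1 i
  obtain ⟨b, b', d, d', h1, h2, h3, h4, -, h5, h6⟩ := h j hij.symm
  exact ⟨a, b, b', ha, hg, h1, h2, h3, h4.trans (h5.1.trans h6)⟩

/-- A gossip message sent after state `m` is received before state `n`, and a FIFO channel delivers
everything older before it. -/
theorem Covers.entered_le_received (hC : R.Covers m n) (hij : i ≠ j) :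
    R.entered i j m ≤ R.received i j n := by
  obtain ⟨a, b, d, hma, -, hab, -, hd, hdn⟩ := hC.exists_receivedAt hij
  obtain ⟨-, hact, hr⟩ := receivedAt_iff.1 hd
  calc R.entered i j m ≤ R.entered i j (b + 1) := entered_mono hij (by omega)
    _ = R.received i j (d + 1) := by rw [← hr, received_succ_of_eq hact]
    _ ≤ R.received i j n := received_mono hdn

theorem Covers.lt_of_receivedAt (hC : R.Covers m n) (hij : i ≠ j) {s d : ℕ} (hs : s < m)
    (h : R.ReceivedAt i j s d) : d < n := by
  by_contra! hnd
  obtain ⟨-, -, hr⟩ := receivedAt_iff.1 h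
  have h1 := entered_mono (R := R) hij (show s + 1 ≤ m from hs)
  have h2 := hC.entered_le_received hij
  have h3 := received_mono (R := R) (i := i) (j := j) hnd
  omega

theorem Covers.lt_of_receivesInitial (hC : R.Covers 0 n) (hij : i ≠ j) {d : ℕ}
    (h : R.ReceivesInitial i j d) : d < n := by
  by_contra! hnd
  have h1 : R.received i j d < ((R.st 0).chan i j).length := h.2
  have h2 := hC.entered_le_received hij
  have h3 := received_mono (R := R) (i := i) (j := j) hnd
  unfold entered at h2
  omega

theorem rank_succ_le (h : (R.st n).client i ≠ .idle) :
    ((R.st (n + 1)).client i).rank ≤ ((R.st n).client i).rank := by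
  rcases (R.step n).client_cases i with ⟨h', -⟩ | ⟨-, r, acks, h1, -, h2⟩ |
    ⟨-, r, acks, acks', h1, h2, -⟩
  · exact absurd h' h
  · rw [h1, h2, ← rank_nextClient i]
    exact Nat.le_succ _
  · rw [h1, h2, Client.rank_busy_eq]

theorem rank_antitone (hmn : m ≤ n) (h : ∀ p, m ≤ p → p < n → (R.st p).client i ≠ .idle) :
    ((R.st n).client i).rank ≤ ((R.st m).client i).rank := by
  induction n, hmn using Nat.le_induction with
  | base => exact le_rfl
  | succ n hmn ih =>
    exact (rank_succ_le (h n hmn n.lt_succ_self)).trans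
      (ih fun p hp hp' => h p hp (hp'.trans n.lt_succ_self))

theorem client_of_ret (h : R.act n = .ret i) : ∃ r acks, (R.st n).client i = .busy r acks ∧
    IsQuorum k e (Finset.univ.filter fun j => acks j ≠ none) ∧
    (R.st (n + 1)).client i = nextClient i r acks := by
  have hs := R.step n
  rw [h] at hs
  obtain ⟨r, acks, h1, h2, hs⟩ := hs
  exact ⟨r, acks, h1, h2, by rw [hs]; exact Function.update_self _ _ _⟩

/-- The cycle contains a return of the client. A return lowers the rank by one, and no other step of
a running client raises it. -/
theorem Covers.rank_lt (hC : R.Covers m n)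
    (h : ∀ p, m ≤ p → p < n → (R.st p).client i ≠ .idle) :
    ((R.st n).client i).rank < ((R.st m).client i).rank := by
  obtain ⟨q, hmq, hqn, hq⟩ := hC.2 i ⟨m, le_rfl, hC.lt, h m le_rfl hC.lt⟩
  obtain ⟨r, acks, h1, -, h2⟩ := client_of_ret hq
  calc ((R.st n).client i).rank ≤ ((R.st (q + 1)).client i).rank :=
        rank_antitone hqn fun p hp => h p (by omega)
    _ < ((R.st q).client i).rank := by
        rw [h1, h2, ← rank_nextClient i]
        exact Nat.lt_succ_self _
    _ ≤ ((R.st m).client i).rank := rank_antitone hmq fun p hp hp' => h p hp (hp'.trans hqn)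

/-! ### Sequences of cycles and the duration of operations -/

/-- The client is idle just before, so only an invocation can have made it run. -/
theorem client_of_isWriteOp {b : ℕ} (h : R.IsWriteOp i b) (hb : b ≠ 0) :
    ∃ s, (R.st b).client i = .busy (.wQry s) fun _ => none := by
  obtain ⟨⟨-, -, h0⟩, r, acks, hr, hw⟩ := h
  have h0 := h0.resolve_left hb
  have hs := R.step (b - 1)
  rw [show b - 1 + 1 = b by omega] at hs
  rcases hs.client_cases i with ⟨-, h1 | h1 | h1⟩ | ⟨-, r, acks, h1, -⟩ | ⟨-, r, acks, -, h1, -⟩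
  · simp [h1] at hr
  · exact h1
  · rw [h1] at hr
    obtain ⟨rfl, -⟩ := Client.busy.inj hr
    exact hw.elim
  · simp [h0] at h1
  · simp [h0] at h1

/-- `cyc t` is the state in which the `t`-th asynchronous cycle ends. -/
structure IsCycleSeq (R : Execution P) (cyc : ℕ → ℕ) : Prop where
  zero : cyc 0 = 0
  isCycle : ∀ t, R.IsCycle (cyc t) (cyc (t + 1))

theorem exists_isCycleSeq (hF : R.Fair) (hL : R.Legal) (hN : 2 ≤ N) (hk : k + 2 * e ≤ N) :
    ∃ cyc, R.IsCycleSeq cyc := by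
  choose f hf using exists_isCycle hF hL hN hk
  exact ⟨fun t => Nat.rec 0 (fun _ m => f m) t, rfl, fun t => hf _⟩

namespace IsCycleSeq

variable {cyc : ℕ → ℕ} {b t : ℕ}

theorem covers (hc : R.IsCycleSeq cyc) (t : ℕ) : R.Covers (cyc t) (cyc (t + 1)) := (hc.isCycle t).2.1

theorem mono (hc : R.IsCycleSeq cyc) {s t : ℕ} (h : s ≤ t) : cyc s ≤ cyc t :=
  monotone_nat_of_le_succ (fun t => (hc.isCycle t).1) h

theorem withinCycles (hc : R.IsCycleSeq cyc) (s C : ℕ) : R.WithinCycles (cyc s) C (cyc (s + C)) := by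
  refine ⟨cyc (s + C), ?_, hc.mono (Nat.le_add_right s C), le_rfl⟩
  induction C with
  | zero => rfl
  | succ C ih => exact ⟨_, ih, hc.isCycle _⟩

/-- The rank is at most `4`, and each of four full cycles would lower it, leaving an idle client. -/
theorem lt_of_ongoing (hc : R.IsCycleSeq cyc) (hb : b ≤ cyc t) (h : R.Ongoing i b n) : n < cyc (t + 4) := by
  by_contra! hn
  have hne : ∀ p, cyc t ≤ p → p ≤ cyc (t + 4) → (R.st p).client i ≠ .idle :=
    fun p hp hp' => h.2.1 p (hb.trans hp) (hp'.trans hn)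
  have hlt : ∀ s, s < 4 → ((R.st (cyc (t + s + 1))).client i).rank <
      ((R.st (cyc (t + s))).client i).rank := fun s hs =>
    (hc.covers (t + s)).rank_lt fun p hp hp' => hne p ((hc.mono (by omega)).trans hp)
      (hp'.le.trans (hc.mono (by omega)))
  have h0 := hlt 0 (by omega)
  have h1 := hlt 1 (by omega)
  have h2 := hlt 2 (by omega)
  have h3 := hlt 3 (by omega)
  have h4 := ((R.st (cyc t)).client i).rank_le
  simp only [add_assoc, add_zero, Nat.reduceAdd] at h0 h1 h2 h3
  exact hne _ (hc.mono (by omega)) le_rfl (Client.eq_idle_of_rank (by omega))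

theorem lt_of_opStep (hc : R.IsCycleSeq cyc) (hb : b ≤ cyc t) (h : R.OpStep i b n) : n < cyc (t + 6) := by
  have h45 : cyc (t + 4) ≤ cyc (t + 5) := hc.mono (by omega)
  have h56 : cyc (t + 5) ≤ cyc (t + 6) := hc.mono (by omega)
  have h14 : cyc 1 ≤ cyc (t + 4) := hc.mono (by omega)
  have h01 : R.Covers 0 (cyc 1) := by simpa [hc.zero] using hc.covers 0
  -- The bound is refined by the kind of step: client steps end first, receptions of requests one
  -- cycle later, receptions of replies after another. The direction of the channel tells the last
  -- two apart in the induction.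
  suffices n < cyc (t + 4) ∨ (n < cyc (t + 5) ∧ ∃ l, R.act n = .recv i l) ∨
      (n < cyc (t + 6) ∧ ∃ l, R.act n = .recv l i) by omega
  induction h with
  | invocation n h =>
    have := hc.mono (show t ≤ t + 4 by omega)
    omega
  | client n h => exact Or.inl (hc.lt_of_ongoing hb h)
  | initialRequest n j q _ h =>
    exact Or.inl ((h01.lt_of_receivesInitial (h.1 ▸ R.step n).recv_ne h).trans_le h14)
  | initialReply n j q a _ h =>
    exact Or.inl ((h01.lt_of_receivesInitial (h.1 ▸ R.step n).recv_ne h).trans_le h14)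
  | request s n j _ hs h ih =>
    have ih : s < cyc (t + 4) := by simpa [hs] using ih
    exact Or.inr (Or.inl ⟨(hc.covers (t + 4)).lt_of_receivedAt (h.2.1 ▸ R.step n).recv_ne ih h,
      j, h.2.1⟩)
  | reply s n j _ hs h ih =>
    have hij : i ≠ j := (hs ▸ R.step s).recv_ne
    have ih : s < cyc (t + 5) := by
      rcases ih with ih | ih | ⟨-, l, hl⟩
      · omega
      · exact ih.1
      · rw [hs, Action.recv.injEq] at hl
        exact absurd hl.2.symm hij
    exact Or.inr (Or.inr ⟨(hc.covers (t + 5)).lt_of_receivedAt hij.symm ih h, j, h.2.1⟩)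

theorem lt_of_suffixIncludes (hc : R.IsCycleSeq cyc) (h : R.SuffixIncludes (cyc (t + 6)) i b) : cyc t < b := by
  by_contra! hb
  obtain ⟨n, hn, h | h⟩ := h
  · exact (hc.lt_of_ongoing hb h).not_ge ((hc.mono (by omega)).trans hn)
  · exact (hc.lt_of_opStep hb h).not_ge hn

/-- The operation has bounded duration, so there is a first idle state after its start; only a
return can lead to it. -/
theorem complete_of_ongoing (hc : R.IsCycleSeq cyc) (hb : b ≠ 0) (h : R.Ongoing i b b) : R.Complete i b := by
  have hid : ∃ n, b ≤ n ∧ (R.st n).client i = .idle := by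
    by_contra! hne
    -- Cycles are nonempty, so `cyc` is strictly increasing.
    have hle : b ≤ cyc b := by
      refine Nat.rec (Nat.zero_le _) (fun t ih => ?_) b
      exact ih.trans_lt (hc.covers t).lt
    exact (hc.lt_of_ongoing (t := b) (n := b ⊔ cyc (b + 4)) hle
      ⟨le_sup_left, fun p hp _ => hne p hp, h.2.2⟩).not_ge le_sup_right
  obtain ⟨hbn, hn⟩ := Nat.find_spec hid
  have hmin : ∀ p, b ≤ p → p < Nat.find hid → (R.st p).client i ≠ .idle :=
    fun p hp hp' hi => Nat.find_min hid hp' ⟨hp, hi⟩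
  generalize Nat.find hid = n at hbn hn hmin
  have hlt : b < n := lt_of_le_of_ne hbn fun h' => h.2.1 b le_rfl le_rfl (h' ▸ hn)
  obtain ⟨n, rfl⟩ : ∃ q, n = q + 1 := ⟨n - 1, by omega⟩
  refine ⟨hb, n, ⟨by omega, fun p hp hp' => hmin p hp (by omega), h.2.2⟩, ?_, hn⟩
  rcases (R.step n).client_cases i with ⟨h1, -⟩ | ⟨h1, -⟩ | ⟨-, r, acks, acks', -, h1, -⟩
  · exact absurd h1 (hmin n (by omega) n.lt_succ_self)
  · exact h1
  · simp [hn] at h1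

end IsCycleSeq

end Execution

/-! ### Tags of requests, fresh rounds and the choice of a new tag -/

theorem Round.request_tags {N k e : ℕ} {Sec : Type u} {Word : Type v} (P : Setup N k e Sec Word)
    (j : Fin N) (r : Round N Sec) : (r.request P j).tags = r.tags := by
  cases r <;> rfl

theorem acks_of_nextClient {N : ℕ} [NeZero N] {Sec : Type u} {Word : Type v} {i : Fin N}
    {r r' : Round N Sec} {acks acks' : Fin N → Option (Reply N Word)}
    (h : nextClient i r acks = .busy r' acks') (j : Fin N) : acks' j = none := by
  cases r <;> simp only [nextClient, Client.busy.injEq, reduceCtorEq] at h <;> rw [← h.2]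

theorem lt_of_le_maxAck {N : ℕ} [NeZero N] {Word : Type v}
    {acks : Fin N → Option (Reply N Word)} {t : Tag N} (h : t ≤ maxAck acks) (i : Fin N) :
    t < toLex ((ofLex (maxAck acks)).1 + 1, i) :=
  h.trans_lt (Prod.Lex.lt_iff.2 (Or.inl (Nat.lt_succ_self _)))

theorem IsQuorum.nonempty {N k e : ℕ} [NeZero N] {A : Finset (Fin N)} (h : IsQuorum k e A) :
    A.Nonempty := by
  rw [← Finset.card_pos]
  have := NeZero.pos N
  unfold IsQuorum at h
  omega

namespace Execution

variable {N k e : ℕ} [NeZero N] {Sec : Type u} {Word : Type v} {P : Setup N k e Sec Word}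
  {R : Execution P} {i j : Fin N} {m n : ℕ}

/-! ### The tags that servers store -/

/-- The tags that some server stores in state `n`, and the least tag. -/
def storedTags (R : Execution P) (n : ℕ) : Set (Tag N) :=
  {t | t = ⊥ ∨ ∃ i, t ∈ storeTags ((R.st n).store i)}

theorem storeTags_mono (hmn : m ≤ n) (i : Fin N) :
    storeTags ((R.st m).store i) ⊆ storeTags ((R.st n).store i) :=
  monotone_nat_of_le_succ (f := fun n => storeTags ((R.st n).store i))
    (fun n => (R.step n).storeTags_subset i) hmn

theorem storedTags_mono (hmn : m ≤ n) : R.storedTags m ⊆ R.storedTags n :=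
  fun _ ht => ht.imp_right fun ⟨i, hi⟩ => ⟨i, storeTags_mono hmn i hi⟩

theorem storeTags_subset_storedTags (i : Fin N) :
    storeTags ((R.st n).store i) ⊆ R.storedTags n :=
  fun _ ht => Or.inr ⟨i, ht⟩

theorem recv_gossip (ha : R.act n = .recv i j) {g : Triple N}
    (hg : ((R.st n).chan i j).head? = some (.gossip g)) :
    ∃ m, GossipUpdate k e j (Function.update ((R.st n).gossip j) i g) ((R.st n).store j)
        ((R.st (n + 1)).store j) m ∧
      (R.st (n + 1)).gossip j = Function.update (Function.update ((R.st n).gossip j) i g) j m ∧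
      (R.st (n + 1)).gossipTx j = tagTuple ((R.st (n + 1)).store j) := by
  obtain ⟨l, hl⟩ := List.head?_eq_some_iff.1 hg
  exact (ha ▸ R.step n).recv_gossip hl

theorem gossip_cases (n : ℕ) (j : Fin N) :
    ((R.st (n + 1)).gossip j = (R.st n).gossip j ∧
      (R.st (n + 1)).gossipTx j = (R.st n).gossipTx j) ∨
    ∃ i g, R.DeliversGossip i j g n := by
  rcases (R.step n).gossip_cases j with h | ⟨i, g, l, h1, h2⟩
  · exact Or.inl h
  · exact Or.inr ⟨i, g, h1, by rw [h2, List.head?_cons]⟩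

/-- A server that has received gossip sends the maximal tags of a later storage. -/
theorem gossipTx_eq {a : ℕ} {g : Triple N} (h : R.DeliversGossip j i g a) (hn : a < n) :
    ∃ s, a < s ∧ s ≤ n ∧ (R.st n).gossipTx i = tagTuple ((R.st s).store i) := by
  induction n, hn using Nat.le_induction with
  | base =>
    obtain ⟨-, -, -, h⟩ := recv_gossip h.1 h.2
    exact ⟨a + 1, a.lt_succ_self, le_rfl, h⟩
  | succ n hn ih =>
    rcases R.gossip_cases n i with ⟨-, h⟩ | ⟨l, g', h⟩
    · obtain ⟨s, h1, h2, h3⟩ := ih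
      exact ⟨s, h1, h2.trans n.le_succ, h.trans h3⟩
    · obtain ⟨-, -, -, h⟩ := recv_gossip h.1 h.2
      exact ⟨n + 1, by omega, le_rfl, h⟩

theorem Covers.exists_deliversGossip (hC : R.Covers m n) (i : Fin N) :
    ∃ a l g, m ≤ a ∧ a < n ∧ R.DeliversGossip l i g a := by
  obtain ⟨a, ha, ⟨l, g, hl, hg⟩, h⟩ := hC.1 i
  obtain ⟨b, b', d, d', h1, -, h2, h3, -, h4, h5⟩ := h l hl
  exact ⟨a, l, g, ha, h1.trans (h2.1.trans (h3.trans (h4.1.trans h5))), hg⟩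

theorem Covers.exists_deliversGossip_of_ne (hC : R.Covers m n) (hij : i ≠ j) :
    ∃ a l g b d, m ≤ a ∧ R.DeliversGossip l i g a ∧ a < b ∧ b < d ∧ d < n ∧
      R.DeliversGossip i j ((R.st b).gossipTx i) d := by
  obtain ⟨a, b, d, hma, ⟨l, g, -, hg⟩, hab, hb, hd, hdn⟩ := hC.exists_receivedAt hij
  exact ⟨a, l, g, b, d, hma, hg, hab, hd.1, hdn, hd.2.1,
    head?_of_receivedAt hij hd (chan_of_gossipSend hb)⟩

/-- In one cycle, a stored tag spreads to all servers. -/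
theorem Covers.le_maxPhase (hC : R.Covers m n) {t : Tag N} (ht : t ∈ R.storedTags m)
    (i : Fin N) : t ≤ maxPhase ((R.st n).store i) Set.univ := by
  rcases ht with rfl | ⟨j, hj⟩
  · exact bot_le
  by_cases hij : j = i
  · subst hij
    exact le_maxPhase_univ (storeTags_mono hC.lt.le j hj)
  -- Server `j` first receives gossip itself, at `a`. This renews its outgoing message from a
  -- storage that contains `t`, before the message is sent at `b`.
  · obtain ⟨a, l, g, b, d, hma, hg, hab, -, hdn, hd⟩ := hC.exists_deliversGossip_of_ne hij
    obtain ⟨s, has, -, hs⟩ := gossipTx_eq hg hab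
    obtain ⟨x, hx, -⟩ := recv_gossip hd.1 hd.2
    calc t ≤ ((R.st b).gossipTx j).pre := by
          rw [hs]
          exact le_maxPhase_univ (storeTags_mono (hma.trans has.le) j hj)
      _ ≤ x.pre := by simpa using hx.le_pre j
      _ ≤ maxPhase ((R.st (d + 1)).store i) Set.univ :=
          le_maxPhase_univ (hx.mem_storeTags.2 (Or.inr (Or.inl rfl)))
      _ ≤ maxPhase ((R.st n).store i) Set.univ := maxPhase_univ_mono (storeTags_mono hdn i)

/-! ### Every tag of the state is traced back to the storages -/

namespace IsCycleSeq

variable {cyc : ℕ → ℕ} {b t : ℕ}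

theorem forall_mem_chan (hc : R.IsCycleSeq cyc) (hij : i ≠ j) (hn : cyc (t + 1) ≤ n)
    {p : Msg N Word → Prop}
    (hp : ∀ s, cyc t ≤ s → s < n → ∀ x, Sends P i j (R.st s) (R.st (s + 1)) x → p x) :
    ∀ x ∈ (R.st n).chan i j, p x :=
  Execution.forall_mem_chan hij ((hc.mono t.le_succ).trans hn) hp
    (((hc.covers t).entered_le_received hij).trans (received_mono hn))

theorem gossipTx_tags_subset (hc : R.IsCycleSeq cyc) (hn : cyc 1 ≤ n) (i : Fin N) :
    ((R.st n).gossipTx i).tags ⊆ R.storedTags n := by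
  obtain ⟨a, l, g, -, han, hg⟩ := (hc.covers 0).exists_deliversGossip i
  obtain ⟨s, -, hsn, hs⟩ := gossipTx_eq hg (han.trans_le hn)
  rw [hs]
  exact fun u hu => storedTags_mono hsn ((tagTuple_tags hu).imp_right fun h => ⟨i, h⟩)

/-- The first cycle renews the outgoing gossip of every server from its storage; the second flushes
the messages sent before. -/
theorem gossip_msg_tags_subset (hc : R.IsCycleSeq cyc) (hij : i ≠ j) (hn : cyc 2 ≤ n)
    {g : Triple N} (hg : .gossip g ∈ (R.st n).chan i j) : g.tags ⊆ R.storedTags n := by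
  refine hc.forall_mem_chan (t := 1) (p := fun x => ∀ g, x = .gossip g → g.tags ⊆ R.storedTags n)
    hij hn (fun s hs hsn x hx g hg => ?_) _ hg g rfl
  cases hx with
  | gossip =>
    obtain rfl := Msg.gossip.inj hg
    exact (hc.gossipTx_tags_subset hs i).trans (storedTags_mono hsn.le)
  | request r acks _ => cases hg
  | ack q a _ => cases hg

/-- Once the initial messages are flushed, each acknowledgment in transit was produced by a server,
which stored the tag of the request when it served it. -/
theorem ack_msg_tags (hc : R.IsCycleSeq cyc) (hij : i ≠ j) (hn : cyc 1 ≤ n)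
    {q : Request N Word} {a : Reply N Word} (ha : .ack q a ∈ (R.st n).chan i j) :
    a.tag ∈ R.storedTags n ∧ q.tags ⊆ R.storedTags n := by
  refine hc.forall_mem_chan (t := 0) (p := fun x => ∀ q a, x = .ack q a →
    a.tag ∈ R.storedTags n ∧ q.tags ⊆ R.storedTags n)
    hij hn (fun s _ hsn x hx q a hq => ?_) _ ha q a rfl
  cases hx with
  | gossip => cases hq
  | request r acks _ => cases hq
  | ack q' a' h =>
    obtain ⟨rfl, rfl⟩ := Msg.ack.inj hq
    exact ⟨storedTags_mono hsn (h.reply_tag.imp_right fun h => ⟨i, h⟩),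
      h.request_tags_subset.trans ((storeTags_subset_storedTags i).trans (storedTags_mono hsn))⟩

/-- In the third cycle the entry is overwritten: for `l = j` by tags just stored, otherwise by a
message from `l`, which is trustworthy after two cycles. -/
theorem gossip_tags_subset (hc : R.IsCycleSeq cyc) (hn : cyc 3 ≤ n) (j l : Fin N) :
    ((R.st n).gossip j l).tags ⊆ R.storedTags n := by
  have hrecv : ∀ d i g, cyc 2 ≤ d → R.DeliversGossip i j g d →
      ((R.st (d + 1)).gossip j l).tags ⊆ R.storedTags (d + 1) ∨
      (l ≠ j ∧ l ≠ i ∧ (R.st (d + 1)).gossip j l = (R.st d).gossip j l) := by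
    intro d i g hd hg
    obtain ⟨x, hx, hx', -⟩ := recv_gossip hg.1 hg.2
    rw [hx']
    by_cases hlj : l = j
    · subst hlj
      rw [Function.update_self]
      exact Or.inl fun u hu => Or.inr ⟨l, hx.mem_storeTags.2 (Or.inr hu)⟩
    by_cases hli : l = i
    · subst hli
      rw [Function.update_of_ne hlj, Function.update_self]
      exact Or.inl ((hc.gossip_msg_tags_subset hlj hd (List.mem_of_mem_head? hg.2)).trans
        (storedTags_mono d.le_succ))
    · rw [Function.update_of_ne hlj, Function.update_of_ne hli]
      exact Or.inr ⟨hlj, hli, rfl⟩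
  obtain ⟨d, i, g, hd, hdn, hg, hl⟩ : ∃ d i g, cyc 2 ≤ d ∧ d < cyc 3 ∧ R.DeliversGossip i j g d ∧
      (l = j ∨ l = i) := by
    by_cases hlj : l = j
    · obtain ⟨a, i, g, h1, h2, h3⟩ := (hc.covers 2).exists_deliversGossip j
      exact ⟨a, i, g, h1, h2, h3, Or.inl hlj⟩
    · obtain ⟨a, -, -, b, d, h1, -, h2, h3, h4, h5⟩ :=
        (hc.covers 2).exists_deliversGossip_of_ne hlj
      exact ⟨d, l, _, h1.trans (h2.trans h3).le, h4, h5, Or.inr rfl⟩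
  replace hn : d + 1 ≤ n := hdn.trans_le hn
  induction n, hn using Nat.le_induction with
  | base => exact (hrecv d i g hd hg).resolve_right fun h => hl.elim h.1 h.2.1
  | succ n hn ih =>
    rcases R.gossip_cases n j with ⟨h, -⟩ | ⟨i', g', h⟩
    · rw [h]
      exact ih.trans (storedTags_mono n.le_succ)
    · rcases hrecv n i' g' (by omega) h with h | ⟨-, -, h⟩
      · exact h
      · rw [h]
        exact ih.trans (storedTags_mono n.le_succ)

theorem client_acks_tags (hc : R.IsCycleSeq cyc) (hn : cyc 2 ≤ n) {r : Round N Sec}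
    {acks : Fin N → Option (Reply N Word)} (h : (R.st n).client i = .busy r acks)
    {a : Reply N Word} (ha : acks j = some a) :
    a.tag ∈ R.storedTags n ∧ r.tags ⊆ R.storedTags n := by
  -- Initial acknowledgments are arbitrary. In the second cycle the client is idle at some point or
  -- returns, so there is a state `p` where it holds none; those collected later come from servers
  -- and match its current request, hence its round.
  obtain ⟨p, hp, hpn, hbase⟩ : ∃ p, cyc 1 ≤ p ∧ p ≤ cyc 2 ∧ ∀ r acks,
      (R.st p).client i = .busy r acks → ∀ j, acks j = none := by
    by_cases hid : ∃ p, cyc 1 ≤ p ∧ p < cyc 2 ∧ (R.st p).client i = .idle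
    · obtain ⟨p, h1, h2, h3⟩ := hid
      exact ⟨p, h1, h2.le, fun r acks h => by simp [h3] at h⟩
    · push Not at hid
      obtain ⟨q, h1, h2, h3⟩ := (hc.covers 1).2 i
        ⟨cyc 1, le_rfl, (hc.covers 1).lt, hid _ le_rfl (hc.covers 1).lt⟩
      obtain ⟨r, acks, -, -, h4⟩ := client_of_ret h3
      exact ⟨q + 1, h1.trans q.le_succ, h2, fun r' acks' h => acks_of_nextClient (h4.symm.trans h)⟩
  replace hn : p ≤ n := hpn.trans hn
  induction n, hn using Nat.le_induction generalizing r acks j a with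
  | base => simp [hbase r acks h] at ha
  | succ n hn ih =>
    have mono := storedTags_mono (R := R) n.le_succ
    rcases (R.step n).client_cases i with ⟨-, h1 | ⟨s, h1⟩ | h1⟩ | ⟨-, r', acks', -, -, h1⟩ |
      ⟨-, r', b, b', h1, h2, -, h3⟩
    · simp [h1] at h
    · obtain ⟨-, rfl⟩ := Client.busy.inj (h1.symm.trans h)
      cases ha
    · obtain ⟨-, rfl⟩ := Client.busy.inj (h1.symm.trans h)
      cases ha
    · rw [acks_of_nextClient (h1.symm.trans h) j] at ha
      cases ha
    · obtain ⟨rfl, rfl⟩ := Client.busy.inj (h2.symm.trans h)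
      rcases h3 j a ha with h4 | ⟨hj, h4⟩ | h4
      · exact (ih h1 h4).imp (fun h => mono h) fun h => h.trans mono
      · have := hc.ack_msg_tags hj (hp.trans hn) h4
        rw [Round.request_tags] at this
        exact this.imp (fun h => mono h) fun h => h.trans mono
      · have := h4.request_tags_subset
        rw [Round.request_tags] at this
        exact ⟨h4.reply_tag.imp_right fun h => ⟨i, h⟩,
          this.trans (storeTags_subset_storedTags i)⟩

theorem exists_first_ret {r : Round N Sec} {acks : Fin N → Option (Reply N Word)}
    (hm : (R.st m).client i = .busy r acks) (h : ∃ n, m ≤ n ∧ R.act n = .ret i) :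
    ∃ n, m ≤ n ∧ (∀ q, m ≤ q → R.act q = .ret i → n ≤ q) ∧ ∃ acks',
      (R.st n).client i = .busy r acks' ∧
      (∃ j, acks' j ≠ none) ∧ (R.st (n + 1)).client i = nextClient i r acks' := by
  obtain ⟨hmn, hn⟩ := Nat.find_spec h
  obtain ⟨acks', h1, -⟩ := busy_of_forall_ne_ret hmn hm fun p hp hp' hr =>
    Nat.find_min h hp' ⟨hp, hr⟩
  obtain ⟨r', b, h2, h3, h4⟩ := client_of_ret hn
  obtain ⟨rfl, rfl⟩ := Client.busy.inj (h1.symm.trans h2)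
  obtain ⟨j, hj⟩ := h3.nonempty
  exact ⟨_, hmn, fun q hq hq' => Nat.find_min' h ⟨hq, hq'⟩, acks', h1,
    ⟨j, (Finset.mem_filter.1 hj).2⟩, h4⟩

/-- At `cyc t` the tag may not be stored anywhere, but the client returns within the cycle. It then
holds an acknowledgment, and the server that gave it has stored the tag. -/
theorem round_tags_subset (hc : R.IsCycleSeq cyc) (ht : 2 ≤ t) {r : Round N Sec}
    {acks : Fin N → Option (Reply N Word)} (h : (R.st (cyc t)).client i = .busy r acks) :
    r.tags ⊆ R.storedTags (cyc (t + 1)) := by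
  obtain ⟨q, h1, h2, h3⟩ := (hc.covers t).2 i ⟨cyc t, le_rfl, (hc.covers t).lt, by simp [h]⟩
  obtain ⟨n, hn, hmin, acks', hb, ⟨j, hj⟩, -⟩ := exists_first_ret h ⟨q, h1, h3⟩
  obtain ⟨a, ha⟩ := Option.ne_none_iff_exists'.1 hj
  exact (hc.client_acks_tags ((hc.mono ht).trans hn) hb ha).2.trans
    (storedTags_mono ((hmin q h1 h3).trans h2.le))

theorem request_tags_subset (hc : R.IsCycleSeq cyc) (hij : i ≠ j) {q : Request N Word}
    (hq : .request q ∈ (R.st (cyc t)).chan i j) : q.tags ⊆ R.storedTags (cyc (t + 1)) := by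
  obtain ⟨d, -, hdn, hd, hh⟩ := exists_recv_of_mem hij hq ((hc.covers t).entered_le_received hij)
  obtain ⟨l, hl⟩ := List.head?_eq_some_iff.1 hh
  exact ((hd ▸ R.step d).recv_request hl).2.trans
    ((storeTags_subset_storedTags j).trans (storedTags_mono hdn))

/-- After three cycles, every tag of the system state is stored within one more cycle. -/
theorem tags_subset (hc : R.IsCycleSeq cyc) :
    (R.st (cyc 3)).tags ⊆ R.storedTags (cyc 4) := by
  have mono : R.storedTags (cyc 3) ⊆ R.storedTags (cyc 4) := storedTags_mono (hc.mono (by omega))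
  have h13 : cyc 1 ≤ cyc 3 := hc.mono (by omega)
  have h23 : cyc 2 ≤ cyc 3 := hc.mono (by omega)
  rintro t (⟨i, ht⟩ | ⟨i, l, ht⟩ | ⟨i, ht⟩ | ⟨i, ht⟩ | ⟨i, j, hij, x, hx, ht⟩)
  · exact mono (Or.inr ⟨i, ht⟩)
  · exact mono (hc.gossip_tags_subset le_rfl i l ht)
  · exact mono (hc.gossipTx_tags_subset h13 i ht)
  · cases hb : (R.st (cyc 3)).client i with
    | idle => exact absurd ht (by simp [hb, Client.tags])
    | busy r acks =>
      rw [hb] at ht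
      rcases ht with ht | ⟨j, a, ha, rfl⟩
      · exact hc.round_tags_subset (by omega) hb ht
      · exact mono (hc.client_acks_tags h23 hb ha).1
  · cases x with
    | gossip g => exact mono (hc.gossip_msg_tags_subset hij h23 hx ht)
    | request q => exact hc.request_tags_subset hij hx ht
    | ack q a =>
      rcases ht with rfl | ht
      · exact mono (hc.ack_msg_tags hij h13 hx).1
      · exact mono ((hc.ack_msg_tags hij h13 hx).2 ht)

/-! ### Late queries return large tags, so late writes are valid -/

theorem le_maxPhase (hc : R.IsCycleSeq cyc) {t : Tag N} (ht : t ∈ (R.st (cyc 3)).tags)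
    (hn : cyc 5 ≤ n) (i : Fin N) : t ≤ maxPhase ((R.st n).store i) Set.univ :=
  ((hc.covers 4).le_maxPhase (hc.tags_subset ht) i).trans
    (maxPhase_univ_mono (storeTags_mono hn i))

theorem le_queryReply (hc : R.IsCycleSeq cyc) {t : Tag N} (ht : t ∈ (R.st (cyc 3)).tags)
    (hn : cyc 5 ≤ n) {S' : Finset (Record N Word)} {a : Reply N Word} {corrupt : Prop}
    (h : Serve corrupt ((R.st n).store i) (.qry .writer) S' a) : t ≤ a.tag := by
  obtain ⟨-, rfl⟩ := h
  exact hc.le_maxPhase ht hn i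

/-- An acknowledgment does not tell which query it answers, so a writer may count a stale one. The
sixth cycle removes those produced before all servers had caught up. -/
theorem le_queryAck (hc : R.IsCycleSeq cyc) {t : Tag N} (ht : t ∈ (R.st (cyc 3)).tags)
    (hij : i ≠ j) (hn : cyc 6 ≤ n) {a : Reply N Word}
    (ha : .ack (.qry .writer) a ∈ (R.st n).chan i j) : t ≤ a.tag := by
  refine hc.forall_mem_chan (t := 5) (p := fun x => ∀ a, x = .ack (.qry .writer) a → t ≤ a.tag)
    hij hn (fun s hs _ x hx a hq => ?_) _ ha a rfl
  cases hx with
  | gossip => cases hq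
  | request r acks _ => cases hq
  | ack q' a' h =>
    obtain ⟨rfl, rfl⟩ := Msg.ack.inj hq
    exact hc.le_queryReply ht hs h

/-- The acknowledgments of a query that starts after six cycles have tags at least `t`. -/
theorem le_acks (hc : R.IsCycleSeq cyc) {t : Tag N} (ht : t ∈ (R.st (cyc 3)).tags)
    (hb : cyc 6 ≤ b) {s : Sec} (hm : (R.st b).client i = .busy (.wQry s) fun _ => none)
    (hbn : b ≤ n) (h : ∀ p, b ≤ p → p < n → R.act p ≠ .ret i)
    {acks : Fin N → Option (Reply N Word)} (hn : (R.st n).client i = .busy (.wQry s) acks)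
    {a : Reply N Word} (ha : acks j = some a) : t ≤ a.tag := by
  have h56 : cyc 5 ≤ cyc 6 := hc.mono (by omega)
  induction n, hbn using Nat.le_induction generalizing acks j a with
  | base =>
    obtain ⟨-, rfl⟩ := Client.busy.inj (hm.symm.trans hn)
    cases ha
  | succ n hbn ih =>
    have h' : ∀ p, b ≤ p → p < n → R.act p ≠ .ret i :=
      fun p hp hp' => h p hp (hp'.trans n.lt_succ_self)
    rcases (R.step n).client_cases i with ⟨h1, -⟩ | ⟨h1, -⟩ | ⟨-, r', b, b', h1, h2, -, h3⟩
    · obtain ⟨acks', h2, -⟩ := busy_of_forall_ne_ret hbn hm h'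
      simp [h1] at h2
    · exact absurd h1 (h n hbn n.lt_succ_self)
    · obtain ⟨rfl, rfl⟩ := Client.busy.inj (h2.symm.trans hn)
      rcases h3 j a ha with h4 | ⟨hj, h4⟩ | h4
      · exact ih h' h1 h4
      · exact hc.le_queryAck ht hj (hb.trans hbn) h4
      · exact hc.le_queryReply ht (h56.trans (hb.trans hbn)) h4

theorem validWrite (hc : R.IsCycleSeq cyc) (hb : cyc 6 < b) (h : R.IsWriteOp i b) :
    R.ValidWrite i b := by
  have hb0 : b ≠ 0 := by omega
  obtain ⟨s, hs⟩ := client_of_isWriteOp h hb0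
  have hcomp := hc.complete_of_ongoing hb0 h.1
  obtain ⟨q, hq, hq'⟩ := hcomp.2
  obtain ⟨n, hbn, hmin, acks, hn, ⟨j, hj⟩, hn'⟩ := exists_first_ret hs ⟨q, hq.1, hq'.1⟩
  have hne : ∀ p, b ≤ p → p < n → R.act p ≠ .ret i :=
    fun p hp hp' hr => (hmin p hp hr).not_gt hp'
  -- Step `n` is the first return, which ends the query; state `n + 1` is in the pre-write round and
  -- shows the tag. The state required by validity is the one after three cycles.
  refine ⟨hcomp, _, ⟨n + 1, s, _, ⟨by omega, fun p hp hp' => ?_, h.1.2.2⟩, hn'⟩, cyc 3, ?_, ?_⟩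
  · rcases Nat.le_succ_iff.1 hp' with hp' | rfl
    · exact hq.2.1 p hp (hp'.trans (hmin q hq.1 hq'.1))
    · simp [hn', nextClient]
  · have h34 : cyc 3 < cyc 4 := (hc.covers 3).lt
    have h46 : cyc 4 ≤ cyc 6 := hc.mono (by omega)
    omega
  -- The bound holds for every tag of that state, whether or not it stems from the starting state.
  · rintro t ⟨-, ht⟩
    obtain ⟨a, ha⟩ := Option.ne_none_iff_exists'.1 hj
    refine lt_of_le_maxAck ((hc.le_acks ht hb.le hs hbn hne hn ha).trans ?_) i
    have hle : ((acks j).map Reply.tag).getD ⊥ ≤ maxAck acks :=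
      Finset.le_sup (f := fun j => ((acks j).map Reply.tag).getD ⊥) (Finset.mem_univ j)
    rw [ha] at hle
    exact hle

end IsCycleSeq

end Execution

end CAS

theorem mainTheorem3 :
    ∃ C₁ C₂ : ℕ, ∀ (N k e f : ℕ) [NeZero N] (Sec : Type u) (Word : Type v),
      2 ≤ N → 1 ≤ k → k + 2 * (f + e) ≤ N →
      ∀ (P : CAS.Setup N k e Sec Word) (R : CAS.Execution P), R.Fair → R.Legal →
        ∃ n₁, R.WithinCycles 0 C₁ n₁ ∧
          (∀ i : Fin N, ¬ R.SuffixIncludes n₁ i 0) ∧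
          ∃ n₂, R.WithinCycles n₁ C₂ n₂ ∧
            ∀ (i : Fin N) (b : ℕ), R.IsWriteOp i b → R.SuffixIncludes n₂ i b →
              R.ValidWrite i b := by
  -- Six cycles are four rounds, one cycle for requests and one for replies. The second six make
  -- sure that every remaining operation starts after `cyc 6`, as `validWrite` requires.
  refine ⟨6, 6, fun N k e f _ Sec Word hN _ hk P R hF hL => ?_⟩
  obtain ⟨cyc, hc⟩ := CAS.Execution.exists_isCycleSeq hF hL hN (by omega)
  refine ⟨cyc 6, ?_, fun i h => (hc.lt_of_suffixIncludes (t := 0) h).not_ge (Nat.zero_le _),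
    cyc 12, hc.withinCycles 6 6, fun i b hw h => hc.validWrite (hc.lt_of_suffixIncludes h) hw⟩
  simpa [hc.zero] using hc.withinCycles 0 6
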